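/- Let $n\ge 0$. A marked group $(\Gamma,S)$ is a group $\Gamma$ with an ordered generating family $S=(s_1,\dots,s_n)$ (repetitions and trivial elements allowed). Its relations are the elements of the kernel of the morphism $F_n\to\Gamma$, $a_i\mapsto s_i$, where $F_n$ is the free group on $a_1,\dots,a_n$. Let $\mathcal G_n$ be the set of isomorphism classes of marked groups with $n$ generators, with the topology in which the sets $N_R(\Gamma,S)$, $R>0$, of marked groups having exactly the same relations of length at most $R$ as $(\Gamma,S)$ form a neighbourhood basis of $(\Gamma,S)$. For a totally ordered abelian group $\Lambda$, a $\Lambda$-tree is a non-empty geodesic $\Lambda$-metric space $T$ such that $d(x,y)+d(u,v)\le\max\{d(x,u)+d(y,v),\,d(x,v)+d(y,u)\}$ and $d(x,y)+d(y,z)-d(x,z)\in 2\Lambda$ for all points. An inversion is an isometry without fixed point whose square has a fixed point. A group acts freely on a $\Lambda$-tree if it acts by isometries, no element is an inversion, and no non-trivial element fixes a point. For a field $K$ with a valuation $v\colon K\to\Lambda\cup\{\infty\}$, where $\Lambda$ is a totally ordered abelian group, the points of the Bruhat–Tits tree of $SL_2(K)$ are the homothety classes of lattices in $K^2$ (finitely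 generated submodules over the valuation ring that span $K^2$), with the natural action of $SL_2(K)$. A group $\Gamma$ has a free action on a Bruhat–Tits tree if there are such $K,\Lambda,v$ (which may depend on $\Gamma$) and a morphism $j\colon\Gamma\to SL_2(K)$ such that no non-trivial element of $\Gamma$ fixes, through $j$, a point of the Bruhat–Tits tree of $SL_2(K)$. (The action of $SL_2(K)$ on this tree is always by isometries and without inversion.) **Theorem.** Let $\mathcal{BT}\subset\mathcal G_n$ be the set of marked groups having a free action on a Bruhat–Tits tree. Then: 1. $\mathcal{BT}$ is closed in $\mathcal G_n$. 2. Every group in $\mathcal{BT}$ acts freely on a $\Lambda$-tree for some totally ordered abelian group $\Lambda$ with $\dim_{\mathbb Q}(\Lambda\otimes\mathbb Q)\le 3n+1$. 3. In particular, every group in $\mathcal{BT}$ acts freely on an $\mathbb R^{3n+1}$-tree, where $\mathbb R^{3n+1}$ has the lexicographic ordering (leftmost factor of greatest weight). -/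

import Mathlib

open scoped TensorProduct MatrixGroups

universe w u v

/-! ### The space of marked groups -/

/-- A group together with an ordered generating family of cardinality `n`
(repetitions and trivial elements are allowed). -/
structure MarkedGroup (n : ℕ) where
  /-- the underlying group -/
  G : Type w
  [group : Group G]
  /-- the generating family -/
  gen : Fin n → G
  closure_gen : Subgroup.closure (Set.range gen) = ⊤

attribute [instance] MarkedGroup.group

namespace MarkedGroup

variable {n : ℕ}

/-- The relations of a marked group: the kernel of `F_n → G`, `a_i ↦ s_i`. -/
def relations (A : MarkedGroup.{w} n) : Subgroup (FreeGroup (Fin n)) :=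
  (FreeGroup.lift A.gen).ker

/-- Isomorphism of marked groups. -/
def Iso (A B : MarkedGroup.{w} n) : Prop :=
  ∃ φ : A.G ≃* B.G, ∀ i, φ (A.gen i) = B.gen i

theorem Iso.relations_eq {A B : MarkedGroup.{w} n} (h : A.Iso B) :
    A.relations = B.relations := by
  obtain ⟨φ, hφ⟩ := h
  have key : (φ.toMonoidHom).comp (FreeGroup.lift A.gen) = FreeGroup.lift B.gen := by
    ext i
    simp [hφ]
  ext x
  simp only [relations, MonoidHom.mem_ker, ← key]
  simp

instance isoSetoid (n : ℕ) : Setoid (MarkedGroup.{w} n) where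
  r := Iso
  iseqv :=
    { refl := fun A => ⟨MulEquiv.refl _, fun _ => rfl⟩
      symm := by
        rintro A B ⟨φ, h⟩
        exact ⟨φ.symm, fun i => by rw [← h i, MulEquiv.symm_apply_apply]⟩
      trans := by
        rintro A B C ⟨φ, h⟩ ⟨ψ, k⟩
        exact ⟨φ.trans ψ, fun i => by rw [MulEquiv.trans_apply, h i, k i]⟩ }

end MarkedGroup

/-- The set of isomorphism classes of marked groups with `n` generators. -/
def MarkedGroupSpace (n : ℕ) : Type (w + 1) :=
  Quotient (MarkedGroup.isoSetoid.{w} n)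

namespace MarkedGroupSpace

variable {n : ℕ}

/-- The isomorphism class of a marked group. -/
def mk (A : MarkedGroup.{w} n) : MarkedGroupSpace.{w} n :=
  Quotient.mk _ A

/-- The relations of (any representative of) a class of marked groups. -/
def relations (x : MarkedGroupSpace.{w} n) : Subgroup (FreeGroup (Fin n)) :=
  Quotient.lift MarkedGroup.relations (fun _ _ h => MarkedGroup.Iso.relations_eq h) x

/-- The set `N_R(x)` of the classes having the same relations of length at most `R` as `x`. -/
def basicNhd (R : ℕ) (x : MarkedGroupSpace.{w} n) : Set (MarkedGroupSpace.{w} n) :=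
  {y | ∀ r : FreeGroup (Fin n), r.norm ≤ R → (r ∈ y.relations ↔ r ∈ x.relations)}

/-- The topology for which the sets `N_R(x)`, `R > 0`, form a neighbourhood basis of `x`. -/
instance : TopologicalSpace (MarkedGroupSpace.{w} n) where
  IsOpen U := ∀ x ∈ U, ∃ R : ℕ, 0 < R ∧ basicNhd R x ⊆ U
  isOpen_univ := fun _ _ => ⟨1, one_pos, Set.subset_univ _⟩
  isOpen_inter := by
    rintro U V hU hV x ⟨hxU, hxV⟩
    obtain ⟨R, hR, h⟩ := hU x hxU
    obtain ⟨S, _, k⟩ := hV x hxV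
    refine ⟨max R S, lt_max_of_lt_left hR, fun y hy => ⟨h ?_, k ?_⟩⟩
    · exact fun r hr => hy r (hr.trans (le_max_left _ _))
    · exact fun r hr => hy r (hr.trans (le_max_right _ _))
  isOpen_sUnion := by
    rintro 𝒰 h𝒰 x ⟨U, hU, hx⟩
    obtain ⟨R, hR, h⟩ := h𝒰 U hU x hx
    exact ⟨R, hR, h.trans (Set.subset_sUnion_of_mem hU)⟩

end MarkedGroupSpace

/-! ### `Λ`-trees and free actions on them -/

section LambdaTrees

variable {Λ : Type*} [AddCommGroup Λ] [LinearOrder Λ]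

/-- `d` makes `T` a `Λ`-metric space. -/
structure IsLambdaMetric {T : Type*} (d : T → T → Λ) : Prop where
  nonneg : ∀ x y, 0 ≤ d x y
  eq_zero_iff : ∀ x y, d x y = 0 ↔ x = y
  symm : ∀ x y, d x y = d y x
  triangle : ∀ x y z, d x z ≤ d x y + d y z

/-- `d` makes `T` a (nonempty) `Λ`-tree: a geodesic `0`-hyperbolic `Λ`-metric space such that
`d x y + d y z - d x z` always lies in `2Λ`. -/
structure IsLambdaTree {T : Type*} (d : T → T → Λ) : Prop extends IsLambdaMetric d where
  nonempty : Nonempty T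
  geodesic : ∀ x y, ∃ a b : Λ, a ≤ b ∧ ∃ f : Λ → T, f a = x ∧ f b = y ∧
    ∀ s ∈ Set.Icc a b, ∀ t ∈ Set.Icc a b, d (f s) (f t) = |s - t|
  hyperbolic : ∀ x y z t, d x y + d z t ≤ max (d x z + d y t) (d x t + d y z)
  even : ∀ x y z, ∃ c : Λ, d x y + d y z - d x z = c + c

end LambdaTrees

/-- The group `G` acts by isometries, freely and without inversion, on some `Λ`-tree. An inversion
is an isometry without fixed point whose square has a fixed point. -/
def ActsFreelyOnTree (Λ : Type*) [AddCommGroup Λ] [LinearOrder Λ] (G : Type*) [Group G] : Prop :=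
  ∃ (T : Type) (d : T → T → Λ) (_ : MulAction G T), IsLambdaTree d ∧
    (∀ (g : G) (x y : T), d (g • x) (g • y) = d x y) ∧
    (∀ g : G, g ≠ 1 → ∀ x : T, g • x ≠ x) ∧
    (∀ g : G, (∃ x : T, (g ^ 2) • x = x) → ∃ x : T, g • x = x)

/-! ### The Bruhat–Tits tree of `SL₂` over a valued field -/

section BruhatTits

variable {K : Type u} [Field K] {Λ : Type v} [AddCommGroup Λ] [LinearOrder Λ] [IsOrderedAddMonoid Λ]

/-- The valuation ring `{x | 0 ≤ v x}` of a valuation `v : K → Λ ∪ {∞}`. -/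
def valRing (v : AddValuation K (WithTop Λ)) : Subring K where
  carrier := {x | 0 ≤ v x}
  mul_mem' := by
    intro a b ha hb
    change 0 ≤ v (a * b)
    rw [AddValuation.map_mul]
    exact add_nonneg ha hb
  one_mem' := by simp
  add_mem' := by
    intro a b ha hb
    exact (le_min ha hb).trans (v.map_add a b)
  zero_mem' := by simp
  neg_mem' := by
    intro a ha
    simpa using ha

/-- Lattices in `K²`: finitely generated submodules over the valuation ring that span `K²`. -/
def ValLattice (v : AddValuation K (WithTop Λ)) : Type u :=
  {L : Submodule (valRing v) (Fin 2 → K) // Submodule.IsLattice K L}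

namespace ValLattice

variable {v : AddValuation K (WithTop Λ)}

/-- The image of a lattice under a `K`-linear automorphism of `K²`. -/
def map (e : (Fin 2 → K) ≃ₗ[K] (Fin 2 → K)) (L : ValLattice v) : ValLattice v :=
  ⟨L.1.map (e.toLinearMap.restrictScalars (valRing v)), by
    obtain ⟨L, hfg, hspan⟩ := L
    refine ⟨hfg.map _, ?_⟩
    have h : ((L.map (e.toLinearMap.restrictScalars (valRing v)) :
        Submodule (valRing v) (Fin 2 → K)) : Set (Fin 2 → K)) = e.toLinearMap '' L := by
      simp
    rw [h, Submodule.span_image, hspan, Submodule.map_top, LinearEquiv.range]⟩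

theorem mem_map {e : (Fin 2 → K) ≃ₗ[K] (Fin 2 → K)} {L : ValLattice v} {x : Fin 2 → K} :
    x ∈ (map e L).1 ↔ ∃ y ∈ L.1, e y = x := by
  simp [map]

theorem ext' {L M : ValLattice v} (h : ∀ x, x ∈ L.1 ↔ x ∈ M.1) : L = M :=
  Subtype.ext (Submodule.ext h)

theorem smulOfUnit_apply' (c : Kˣ) (x : Fin 2 → K) :
    (LinearEquiv.smulOfUnit c : (Fin 2 → K) ≃ₗ[K] (Fin 2 → K)) x = (c : K) • x := rfl

/-- Homothety of lattices: `M = c L` for some nonzero `c` in `K`. -/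
def Homothetic (L M : ValLattice v) : Prop :=
  ∃ c : Kˣ, M = map (LinearEquiv.smulOfUnit c) L

instance homothetySetoid (v : AddValuation K (WithTop Λ)) : Setoid (ValLattice v) where
  r := Homothetic
  iseqv :=
    { refl := fun L => ⟨1, ext' fun x => by simp [mem_map, smulOfUnit_apply']⟩
      symm := by
        rintro L M ⟨c, rfl⟩
        refine ⟨c⁻¹, ext' fun x => ?_⟩
        simp [mem_map, smulOfUnit_apply', smul_smul]
      trans := by
        rintro L M N ⟨c, rfl⟩ ⟨c', rfl⟩
        refine ⟨c' * c, ext' fun x => ?_⟩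
        simp [mem_map, smulOfUnit_apply', mul_smul] }

end ValLattice

/-- The (points of the) Bruhat–Tits tree of `SL₂(K)`: homothety classes of lattices in `K²`. -/
def BruhatTitsTree (v : AddValuation K (WithTop Λ)) : Type u :=
  Quotient (ValLattice.homothetySetoid v)

namespace BruhatTitsTree

variable {v : AddValuation K (WithTop Λ)}

/-- The action of `SL₂(K)` on the Bruhat–Tits tree, `g • [L] = [g L]`. -/
instance : MulAction SL(2, K) (BruhatTitsTree v) where
  smul g := Quotient.map (ValLattice.map (Matrix.SpecialLinearGroup.toLin' g)) (by
    rintro L M ⟨c, rfl⟩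
    refine ⟨c, ValLattice.ext' fun x => ?_⟩
    simp [ValLattice.mem_map, ValLattice.smulOfUnit_apply'])
  one_smul := by
    rintro ⟨L⟩
    refine congrArg (Quotient.mk _) (ValLattice.ext' fun x => ?_)
    simp [ValLattice.mem_map]
  mul_smul := by
    rintro g h ⟨L⟩
    refine congrArg (Quotient.mk _) (ValLattice.ext' fun x => ?_)
    simp [ValLattice.mem_map]

/-- The lattice `O e₀ + O e₁` of a basis `(e₀, e₁)` of `K²`. -/
def ofBasis (e : Module.Basis (Fin 2) K (Fin 2 → K)) : ValLattice v :=
  ⟨Submodule.span (valRing v) (Set.range e), by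
    refine ⟨Submodule.fg_span (Set.finite_range e), ?_⟩
    rw [Submodule.span_span_of_tower, e.span_eq]⟩

/-- `x` and `y` are at distance `r ≥ 0` if there is a basis `(e₀, e₁)` of `K²` and an element `a`
of `K` of valuation `r` such that `x = [O e₀ + O e₁]` and `y = [O e₀ + O a e₁]`. -/
def IsDist (x y : BruhatTitsTree v) (r : Λ) : Prop :=
  0 ≤ r ∧ ∃ (e : Module.Basis (Fin 2) K (Fin 2 → K)) (a : Kˣ), v (a : K) = (r : WithTop Λ) ∧
    x = Quotient.mk _ (ofBasis e) ∧ y = Quotient.mk _ (ofBasis (e.unitsSMul ![1, a]))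

open Classical in
/-- The `Λ`-metric of the Bruhat–Tits tree (the points form a tree over the value group of `v`).
Freeness of an action concerns the points only. -/
noncomputable def dist (x y : BruhatTitsTree v) : Λ :=
  if h : ∃ r : Λ, IsDist x y r then h.choose else 0

end BruhatTitsTree

end BruhatTits

/-- The group `G` has a free action on a Bruhat–Tits tree: for some field `K` with a valuation
`v : K → Λ ∪ {∞}` and some morphism `j : G → SL₂(K)`, the action of `G` through `j` on the
Bruhat–Tits tree of `SL₂(K)` is free. -/
def HasFreeBruhatTitsAction (G : Type w) [Group G] : Prop :=
  ∃ (K : Type u) (_ : Field K) (Λ : Type v) (_ : AddCommGroup Λ) (_ : LinearOrder Λ)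
    (_ : IsOrderedAddMonoid Λ) (v : AddValuation K (WithTop Λ)) (j : G →* SL(2, K)),
    ∀ g : G, g ≠ 1 → ∀ x : BruhatTitsTree v, j g • x ≠ x

/-- The set of (classes of) marked groups having a free action on a Bruhat–Tits tree. -/
def freeBruhatTitsSet (n : ℕ) : Set (MarkedGroupSpace.{w} n) :=
  {x | ∃ A : MarkedGroup.{w} n, MarkedGroupSpace.mk A = x ∧ HasFreeBruhatTitsAction.{w, u, v} A.G}

/-!
Freeness of an action on a Bruhat–Tits tree is a condition on traces: an element `g` of `SL₂(K)`
fixes a homothety class of lattices if and only if `0 ≤ v (tr g)`. Indeed lattices of the plane are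
free, so that an element fixing a class is conjugate to an element of `SL₂(O)`
(`zero_le_trace_of_smul_eq`), and an element of integral trace is scalar or a companion matrix in a
suitable basis (`exists_smul_eq_of_zero_le_trace`). A group is therefore in the set under
consideration if and only if it has a representation in `SL₂(K)` for which the traces of the
non-trivial elements avoid a valuation subring (`HasFreeTrace`). This is how the universe of the
field is changed: the field may be replaced by the countable subfield generated by the coefficients
of the generators, which needs three elements for each generator (`exists_hasFreeTrace`).

*Closedness.* If `A` is a limit of marked groups `B i`, then the ultraproduct of representations of
the `B i` kills the relations of `A`, and the traces of its non-trivial elements avoid the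
ultraproduct of the valuation rings (`hasFreeBruhatTitsAction_of_limit`).

*The trees.* Let `v` be a valuation of `K` with values in an ordered group `Λ` which may be larger
than the value group. To two bases `x`, `y` of the plane with weights in `Λ` on their vectors one
attaches `covol x + covol y - 2 m(x, y)`, where `m(x, y)` is the least weighted valuation of the
determinants of a vector of `x` and a vector of `y`. The four point condition is the Plücker
relation between four vectors (`min_le_minVal_add_minVal`), and it implies the other axioms of a
pseudo-metric. Two vectors for which the minimum is attained form a basis, whose apartment contains
`x` and `y` up to distance `0` (`exists_common_apartment`); this yields geodesics. The group
`SL₂(K)` preserves determinants, hence distances, and an element fixing a point of the quotient has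
integral trace. As weights are arbitrary, no change of base is needed to pass from the tree over the
value group to a tree over a larger group.

*The rank.* The value group of a field generated by `3 n` elements has rank at most `3 n + 1`
(`ValuationSubring.rank_addValueGroup_le`): the valuations of the integers span a group of rank at
most one, and elements whose valuations are independent modulo this group are algebraically
independent over the prime ring. An ordered group of rank at most `N` has at most `N` Archimedean
classes, so that Hahn's theorem embeds it in `ℝ^N` with the lexicographic order
(`exists_strictMono_lex`).
-/

/-! ### The tree of weighted bases -/

section WeightedBases

variable {K : Type*} [Field K] {Λ : Type*}

/-- The determinant of two vectors of the plane. -/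
def wedge (x y : Fin 2 → K) : K := x 0 * y 1 - x 1 * y 0

theorem wedge_self (x : Fin 2 → K) : wedge x x = 0 := by
  simp [wedge, mul_comm]

theorem wedge_swap (x y : Fin 2 → K) : wedge y x = -wedge x y := by
  simp only [wedge]; ring

/-- The Plücker relation between four vectors of the plane. -/
theorem wedge_plucker (x y z t : Fin 2 → K) :
    wedge x y * wedge z t = wedge x z * wedge y t - wedge x t * wedge y z := by
  simp only [wedge]; ring

theorem wedge_smul (g : SL(2, K)) (x y : Fin 2 → K) :
    wedge (g.1.mulVec x) (g.1.mulVec y) = wedge x y := by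
  have h := g.2
  rw [Matrix.det_fin_two] at h
  simp only [wedge, Matrix.mulVec, dotProduct, Fin.sum_univ_two]
  linear_combination (x 0 * y 1 - x 1 * y 0) * h

variable (K Λ) in
/-- A basis of the plane `K²` with a weight in `Λ` on each vector. It stands for the lattice
`O t₀ e₀ + O t₁ e₁`, where `t₀`, `t₁` are scalars having the weights as valuations; as the weights
need not be values of the valuation, such scalars may exist in an extension of `K` only. -/
structure WeightedBasis where
  /-- the basis -/
  vec : Fin 2 → Fin 2 → K
  /-- the weights -/
  wt : Fin 2 → Λ
  wedge_ne : wedge (vec 0) (vec 1) ≠ 0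

namespace WeightedBasis

/-- The action of `SL₂(K)` on weighted bases. -/
instance : MulAction SL(2, K) (WeightedBasis K Λ) where
  smul g x := ⟨fun i => g.1.mulVec (x.vec i), x.wt, by rw [wedge_smul]; exact x.wedge_ne⟩
  one_smul x := by
    change WeightedBasis.mk _ _ _ = x
    congr 1
    funext i
    simp
  mul_smul g h x := by
    change WeightedBasis.mk _ _ _ = WeightedBasis.mk _ _ _
    congr 1
    funext i
    exact (Matrix.mulVec_mulVec _ _ _).symm

theorem vec_smul (g : SL(2, K)) (x : WeightedBasis K Λ) (i : Fin 2) :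
    (g • x).vec i = g.1.mulVec (x.vec i) := rfl

theorem wt_smul (g : SL(2, K)) (x : WeightedBasis K Λ) (i : Fin 2) : (g • x).wt i = x.wt i := rfl

end WeightedBasis

end WeightedBases

section WeightedBases

variable {K : Type*} [Field K] {Λ : Type*} [AddCommGroup Λ] [LinearOrder Λ] [IsOrderedAddMonoid Λ]

namespace WeightedBasis

variable (v : AddValuation K (WithTop Λ))

/-- The valuation as a function to `Λ`, with the junk value `0` at `0`. -/
def val (a : K) : Λ := (v a).untopD 0

variable {v} in
theorem coe_val {a : K} (ha : a ≠ 0) : ((val v a : Λ) : WithTop Λ) = v a := by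
  have h : v a ≠ ⊤ := fun h => ha ((AddValuation.top_iff v).1 h)
  lift v a to Λ using h with b hb
  simp [val, ← hb]

theorem val_neg (a : K) : val v (-a) = val v a := by
  simp [val, AddValuation.map_neg]

theorem val_mul {a b : K} (ha : a ≠ 0) (hb : b ≠ 0) : val v (a * b) = val v a + val v b := by
  have h : ((val v (a * b) : Λ) : WithTop Λ) = (val v a + val v b : Λ) := by
    rw [coe_val (mul_ne_zero ha hb), WithTop.coe_add, coe_val ha, coe_val hb, AddValuation.map_mul]
  exact_mod_cast h

theorem min_val_le_val_sub {a b : K} (ha : a ≠ 0) (hb : b ≠ 0) (hab : a - b ≠ 0) :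
    min (val v a) (val v b) ≤ val v (a - b) := by
  have h : ((min (val v a) (val v b) : Λ) : WithTop Λ) ≤ (val v (a - b) : Λ) := by
    rw [WithTop.coe_min, coe_val ha, coe_val hb, coe_val hab]
    exact v.map_sub a b
  exact_mod_cast h

variable (x y z t : WeightedBasis K Λ)

/-- The valuation of the determinant of the lattice spanned by a weighted basis. -/
def covol : Λ := val v (wedge (x.vec 0) (x.vec 1)) + x.wt 0 + x.wt 1

/-- The determinants of a vector of `x` and a vector of `y` do not all vanish, so that they have a
least weighted valuation. The vanishing ones are left aside because `val` is junk at `0`. -/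
theorem exists_minVal : ∃ m : Λ,
    (∀ i j, wedge (x.vec i) (y.vec j) ≠ 0 →
      m ≤ val v (wedge (x.vec i) (y.vec j)) + x.wt i + y.wt j) ∧
    ∃ i j, wedge (x.vec i) (y.vec j) ≠ 0 ∧
      m = val v (wedge (x.vec i) (y.vec j)) + x.wt i + y.wt j := by
  classical
  let S : Finset (Fin 2 × Fin 2) :=
    Finset.univ.filter fun p => wedge (x.vec p.1) (y.vec p.2) ≠ 0
  have hS : S.Nonempty := by
    by_contra h
    have h0 : ∀ i j, wedge (x.vec i) (y.vec j) = 0 := fun i j => by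
      by_contra hij
      exact h ⟨(i, j), by simpa [S] using hij⟩
    have := wedge_plucker (x.vec 0) (x.vec 1) (y.vec 0) (y.vec 1)
    rw [h0, h0, h0] at this
    exact mul_ne_zero x.wedge_ne y.wedge_ne (by simpa using this)
  obtain ⟨p, hp, hmin⟩ := S.exists_min_image
    (fun p => val v (wedge (x.vec p.1) (y.vec p.2)) + x.wt p.1 + y.wt p.2) hS
  refine ⟨_, fun i j hij => hmin (i, j) (by simpa [S] using hij), p.1, p.2, ?_, rfl⟩
  simpa [S] using hp

/-- The smallest valuation of the determinant of a vector of the first lattice and a vector of the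
second one. -/
noncomputable def minVal : Λ := (exists_minVal v x y).choose

theorem minVal_le {i j : Fin 2} (h : wedge (x.vec i) (y.vec j) ≠ 0) :
    minVal v x y ≤ val v (wedge (x.vec i) (y.vec j)) + x.wt i + y.wt j :=
  (exists_minVal v x y).choose_spec.1 i j h

theorem exists_minVal_eq : ∃ i j, wedge (x.vec i) (y.vec j) ≠ 0 ∧
    minVal v x y = val v (wedge (x.vec i) (y.vec j)) + x.wt i + y.wt j :=
  (exists_minVal v x y).choose_spec.2

theorem eq_minVal {m : Λ} (h : ∀ i j, wedge (x.vec i) (y.vec j) ≠ 0 →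
      m ≤ val v (wedge (x.vec i) (y.vec j)) + x.wt i + y.wt j)
    (h' : ∃ i j, wedge (x.vec i) (y.vec j) ≠ 0 ∧
      m = val v (wedge (x.vec i) (y.vec j)) + x.wt i + y.wt j) : minVal v x y = m := by
  obtain ⟨i, j, hij, hm⟩ := h'
  obtain ⟨k, l, hkl, hm'⟩ := exists_minVal_eq v x y
  exact le_antisymm (hm ▸ minVal_le v x y hij) (hm' ▸ h k l hkl)

theorem minVal_comm : minVal v x y = minVal v y x := by
  refine eq_minVal v x y (fun i j hij => ?_) ?_
  · have h : wedge (y.vec j) (x.vec i) ≠ 0 := by rwa [wedge_swap, neg_ne_zero]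
    have := minVal_le v y x h
    rw [wedge_swap, val_neg] at this
    rwa [add_right_comm]
  · obtain ⟨i, j, hij, h⟩ := exists_minVal_eq v y x
    refine ⟨j, i, by rwa [wedge_swap, neg_ne_zero], ?_⟩
    rw [wedge_swap, val_neg, h, add_right_comm]

theorem minVal_self : minVal v x x = covol v x := by
  have h1 : wedge (x.vec 1) (x.vec 0) = -wedge (x.vec 0) (x.vec 1) := wedge_swap _ _
  refine eq_minVal v x x (fun i j hij => ?_) ⟨0, 1, x.wedge_ne, rfl⟩
  fin_cases i <;> fin_cases j <;> simp [wedge_self] at hij ⊢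
  · rfl
  · rw [h1, val_neg, covol, add_right_comm]

/-- The four point condition, a consequence of the Plücker relation. -/
theorem min_le_minVal_add_minVal :
    min (minVal v x z + minVal v y t) (minVal v x t + minVal v y z) ≤
      minVal v x y + minVal v z t := by
  obtain ⟨i, j, hij, h⟩ := exists_minVal_eq v x y
  obtain ⟨k, l, hkl, h'⟩ := exists_minVal_eq v z t
  have hP := wedge_plucker (x.vec i) (y.vec j) (z.vec k) (t.vec l)
  have hne := mul_ne_zero hij hkl
  have hval := val_mul v hij hkl
  by_cases h1 : wedge (x.vec i) (z.vec k) * wedge (y.vec j) (t.vec l) = 0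
  · rw [h1, zero_sub] at hP
    rw [hP, neg_ne_zero] at hne
    rw [hP, val_neg, val_mul v (left_ne_zero_of_mul hne) (right_ne_zero_of_mul hne)] at hval
    have := minVal_le v x t (left_ne_zero_of_mul hne)
    have := minVal_le v y z (right_ne_zero_of_mul hne)
    grind
  have := minVal_le v x z (left_ne_zero_of_mul h1)
  have := minVal_le v y t (right_ne_zero_of_mul h1)
  have e1 := val_mul v (left_ne_zero_of_mul h1) (right_ne_zero_of_mul h1)
  by_cases h2 : wedge (x.vec i) (t.vec l) * wedge (y.vec j) (z.vec k) = 0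
  · rw [h2, sub_zero] at hP
    rw [hP, e1] at hval
    grind
  have := minVal_le v x t (left_ne_zero_of_mul h2)
  have := minVal_le v y z (right_ne_zero_of_mul h2)
  have e2 := val_mul v (left_ne_zero_of_mul h2) (right_ne_zero_of_mul h2)
  have := min_val_le_val_sub v h1 h2 (hP ▸ hne)
  rw [← hP, hval, e1, e2] at this
  grind

/-- The distance between (the homothety classes of the lattices of) two weighted bases. -/
noncomputable def pdist : Λ := covol v x + covol v y - (minVal v x y + minVal v x y)

theorem pdist_self : pdist v x x = 0 := by
  rw [pdist, minVal_self]; abel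

theorem pdist_comm : pdist v x y = pdist v y x := by
  rw [pdist, pdist, minVal_comm v x y]; abel

theorem pdist_add_pdist_le : pdist v x y + pdist v z t ≤
    max (pdist v x z + pdist v y t) (pdist v x t + pdist v y z) := by
  have := min_le_minVal_add_minVal v x y z t
  simp only [pdist]
  grind

theorem pdist_nonneg : 0 ≤ pdist v x y := by
  have := pdist_add_pdist_le v x x y y
  rw [pdist_self, pdist_self, max_self] at this
  grind

theorem pdist_triangle : pdist v x z ≤ pdist v x y + pdist v y z := by
  have := pdist_add_pdist_le v x z y y
  rw [pdist_self, pdist_comm v z y, max_self] at this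
  simpa using this

/-- The covolumes of `x` and `z` cancel and that of `y` occurs twice. -/
theorem pdist_even : ∃ c, pdist v x y + pdist v y z - pdist v x z = c + c :=
  ⟨covol v y - minVal v x y - minVal v y z + minVal v x z, by simp only [pdist]; abel⟩

variable {x y} in
theorem pdist_congr_left (h : pdist v x y = 0) : pdist v x z = pdist v y z := by
  have h1 := pdist_triangle v x y z
  have h2 := pdist_triangle v y x z
  rw [pdist_comm v y x] at h2
  grind

theorem covol_smul (g : SL(2, K)) : covol v (g • x) = covol v x := by
  simp only [covol, vec_smul, wt_smul, wedge_smul]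

theorem minVal_smul (g : SL(2, K)) : minVal v (g • x) (g • y) = minVal v x y := by
  refine eq_minVal v _ _ (fun i j hij => ?_) ?_
  · simp only [vec_smul, wt_smul, wedge_smul] at hij ⊢
    exact minVal_le v x y hij
  · simp only [vec_smul, wt_smul, wedge_smul]
    exact exists_minVal_eq v x y

theorem pdist_smul (g : SL(2, K)) : pdist v (g • x) (g • y) = pdist v x y := by
  rw [pdist, pdist, covol_smul, covol_smul, minVal_smul]

/-! ### Apartments: the weighted bases supported by a given basis -/

/-- The weighted basis made of two independent vectors. -/
def ofPair (e f : Fin 2 → K) (h : wedge e f ≠ 0) (a b : Λ) : WeightedBasis K Λ :=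
  ⟨![e, f], ![a, b], h⟩

variable {e f : Fin 2 → K}

theorem pdist_ofPair (h : wedge e f ≠ 0) (a b c d : Λ) :
    pdist v (ofPair e f h a b) (ofPair e f h c d) = |(a - b) - (c - d)| := by
  have hf : wedge f e ≠ 0 := by rwa [wedge_swap, neg_ne_zero]
  have h1 : val v (wedge f e) = val v (wedge e f) := by rw [wedge_swap, val_neg]
  have hm : minVal v (ofPair e f h a b) (ofPair e f h c d) =
      val v (wedge e f) + min (a + d) (b + c) := by
    refine eq_minVal v _ _ (fun i j hij => ?_) ?_
    · fin_cases i <;> fin_cases j <;> simp [ofPair, wedge_self] at hij ⊢ <;> grind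
    · rcases le_total (a + d) (b + c) with hle | hle
      · exact ⟨0, 1, h, by simp [ofPair, hle, add_assoc]⟩
      · exact ⟨1, 0, hf, by simp [ofPair, hle, h1, add_assoc]⟩
  rw [pdist, hm]
  simp only [covol, ofPair, Matrix.cons_val_zero, Matrix.cons_val_one]
  rcases abs_cases ((a - b) - (c - d)) with hc | hc <;> grind

/-- If `w` is a vector whose determinant with the vectors of `x` has its least weighted valuation at
`x.vec i`, then `x` lies in the apartment of `x.vec i` and `w`. -/
theorem exists_pdist_ofPair_eq_zero {i : Fin 2} {w : Fin 2 → K}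
    (h : wedge (x.vec i) w ≠ 0)
    (hmin : ∀ k, wedge (x.vec k) w ≠ 0 →
      val v (wedge (x.vec i) w) + x.wt i ≤ val v (wedge (x.vec k) w) + x.wt k) :
    ∃ b, pdist v (ofPair (x.vec i) w h (x.wt i) b) x = 0 := by
  -- the second weight makes the covolumes equal
  refine ⟨covol v x - x.wt i - val v (wedge (x.vec i) w), ?_⟩
  set y := ofPair (x.vec i) w h (x.wt i) (covol v x - x.wt i - val v (wedge (x.vec i) w)) with hy
  have hc : covol v y = covol v x := by
    simp only [covol, hy, ofPair, Matrix.cons_val_zero, Matrix.cons_val_one]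
    abel
  have hm : minVal v x y = covol v x := by
    refine eq_minVal v _ _ (fun k j hij => ?_) ⟨i, 1, h, ?_⟩
    · have hj : j = 0 ∨ j = 1 := by omega
      rcases hj with rfl | rfl
      · have hik : i ≠ k := by
          rintro rfl
          exact hij (wedge_self _)
        have hx := minVal_self v x
        have := minVal_le v x x (i := k) (j := i) hij
        simpa [hy, ofPair, hx] using this
      · have := hmin k hij
        change _ ≤ val v (wedge (x.vec k) w) + x.wt k +
          (covol v x - x.wt i - val v (wedge (x.vec i) w))
        grind
    · change _ = val v (wedge (x.vec i) w) + x.wt i +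
        (covol v x - x.wt i - val v (wedge (x.vec i) w))
      abel
  rw [pdist_comm, pdist, hc, hm]
  abel

/-- Two weighted bases lie, up to distance `0`, in a common apartment. -/
theorem exists_common_apartment : ∃ (e f : Fin 2 → K) (h : wedge e f ≠ 0) (a b c d : Λ),
    pdist v (ofPair e f h a b) x = 0 ∧ pdist v (ofPair e f h c d) y = 0 := by
  obtain ⟨i, j, hij, hm⟩ := exists_minVal_eq v x y
  have hji : wedge (y.vec j) (x.vec i) ≠ 0 := by rwa [wedge_swap, neg_ne_zero]
  obtain ⟨b, hb⟩ := exists_pdist_ofPair_eq_zero v x hij fun k hk => by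
    have := minVal_le v x y hk
    grind
  obtain ⟨c, hc⟩ := exists_pdist_ofPair_eq_zero v y hji fun k hk => by
    have hk' : wedge (x.vec i) (y.vec k) ≠ 0 := by rwa [wedge_swap, neg_ne_zero]
    have := minVal_le v x y hk'
    rw [wedge_swap (x.vec i), val_neg, wedge_swap (x.vec i), val_neg]
    grind
  refine ⟨x.vec i, y.vec j, hij, x.wt i, b, c, y.wt j, hb, ?_⟩
  -- the order of the two vectors of a weighted basis does not matter
  have hsw : pdist v (ofPair (x.vec i) (y.vec j) hij c (y.wt j))
      (ofPair (y.vec j) (x.vec i) hji (y.wt j) c) = 0 := by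
    have h1 : val v (wedge (y.vec j) (x.vec i)) = val v (wedge (x.vec i) (y.vec j)) := by
      rw [wedge_swap, val_neg]
    have hm : minVal v (ofPair (x.vec i) (y.vec j) hij c (y.wt j))
        (ofPair (y.vec j) (x.vec i) hji (y.wt j) c) =
        val v (wedge (x.vec i) (y.vec j)) + c + y.wt j := by
      refine eq_minVal v _ _ (fun k l hkl => ?_) ⟨0, 0, hij, rfl⟩
      fin_cases k <;> fin_cases l <;> simp [ofPair, wedge_self] at hkl ⊢
      grind
    rw [pdist, hm]
    simp only [covol, ofPair, Matrix.cons_val_zero, Matrix.cons_val_one]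
    grind
  rw [pdist_congr_left v _ hsw, hc]

/-- If an element of `SL₂(K)` moves a weighted basis by distance `0`, its trace is integral. -/
theorem zero_le_trace_of_pdist_smul_eq_zero (g : SL(2, K)) (h : pdist v (g • x) x = 0) :
    0 ≤ v g.1.trace := by
  have hm : minVal v (g • x) x = covol v x := by
    rw [pdist, covol_smul] at h
    grind
  -- the trace is computed in the basis `x`
  have htr : g.1.trace * wedge (x.vec 0) (x.vec 1) =
      wedge ((g • x).vec 0) (x.vec 1) - wedge ((g • x).vec 1) (x.vec 0) := by
    simp only [wedge, vec_smul, Matrix.trace_fin_two, Matrix.mulVec, dotProduct, Fin.sum_univ_two]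
    ring
  have key : ∀ i j, i ≠ j →
      v (wedge (x.vec 0) (x.vec 1)) ≤ v (wedge ((g • x).vec i) (x.vec j)) := by
    intro i j hne
    by_cases h0 : wedge ((g • x).vec i) (x.vec j) = 0
    · simp [h0]
    · have := minVal_le v (g • x) x h0
      rw [hm, wt_smul, covol] at this
      rw [← coe_val h0, ← coe_val x.wedge_ne, WithTop.coe_le_coe]
      have : x.wt i + x.wt j = x.wt 0 + x.wt 1 := by
        have : (i = 0 ∧ j = 1) ∨ (i = 1 ∧ j = 0) := by omega
        rcases this with ⟨rfl, rfl⟩ | ⟨rfl, rfl⟩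
        · rfl
        · exact add_comm _ _
      grind
  have hle : v (wedge (x.vec 0) (x.vec 1)) ≤ v (g.1.trace * wedge (x.vec 0) (x.vec 1)) := by
    rw [htr]
    exact (le_min (key 0 1 (by decide)) (key 1 0 (by decide))).trans (v.map_sub _ _)
  rw [AddValuation.map_mul, ← coe_val x.wedge_ne] at hle
  by_cases ht : g.1.trace = 0
  · simp [ht]
  · rw [← coe_val ht] at hle ⊢
    have hle' : val v (wedge (x.vec 0) (x.vec 1)) ≤
        val v g.1.trace + val v (wedge (x.vec 0) (x.vec 1)) := by exact_mod_cast hle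
    have : 0 ≤ val v g.1.trace := by grind
    exact_mod_cast this

/-! ### The quotient tree and its free actions -/

/-- Weighted bases are identified when their distance is `0`. -/
def setoid : Setoid (WeightedBasis K Λ) where
  r x y := pdist v x y = 0
  iseqv :=
    { refl := pdist_self v
      symm := fun {x y} h => by rwa [pdist_comm]
      trans := fun {x y z} h h' => by rwa [pdist_congr_left v z h] }

end WeightedBasis

/-- The tree of weighted bases: the Bruhat–Tits tree, extended by the points whose weights lie in
`Λ` and not in the value group. -/
def WeightedTree (v : AddValuation K (WithTop Λ)) : Type _ :=
  Quotient (WeightedBasis.setoid v)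

namespace WeightedTree

open WeightedBasis

variable {v : AddValuation K (WithTop Λ)}

/-- The `Λ`-metric of the tree of weighted bases. -/
noncomputable def tdist : WeightedTree v → WeightedTree v → Λ :=
  Quotient.lift₂ (pdist v) fun a b c d (h : pdist v a c = 0) (h' : pdist v b d = 0) => by
    rw [pdist_congr_left v b h, pdist_comm, pdist_congr_left v c h', pdist_comm]

instance : MulAction SL(2, K) (WeightedTree v) where
  smul g := Quotient.map (g • ·) fun x y (h : pdist v x y = 0) => by
    change pdist v _ _ = 0
    rwa [pdist_smul]
  one_smul := by
    rintro ⟨x⟩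
    exact congrArg (Quotient.mk _) (one_smul _ x)
  mul_smul := by
    rintro g h ⟨x⟩
    exact congrArg (Quotient.mk _) (mul_smul g h x)

theorem tdist_smul (g : SL(2, K)) (x y : WeightedTree v) : tdist (g • x) (g • y) = tdist x y := by
  induction x, y using Quotient.inductionOn₂ with
  | _ x y => exact pdist_smul v x y g

theorem zero_le_trace_of_smul_eq {g : SL(2, K)} {x : WeightedTree v} (h : g • x = x) :
    0 ≤ v g.1.trace := by
  induction x using Quotient.inductionOn with
  | _ x => exact zero_le_trace_of_pdist_smul_eq_zero v x g (Quotient.exact h)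

theorem isLambdaTree : IsLambdaTree (tdist (v := v)) where
  nonneg := by rintro ⟨x⟩ ⟨y⟩; exact pdist_nonneg v x y
  eq_zero_iff := by
    rintro ⟨x⟩ ⟨y⟩
    exact ⟨fun h => Quotient.sound h, fun h => Quotient.exact h⟩
  symm := by rintro ⟨x⟩ ⟨y⟩; exact pdist_comm v x y
  triangle := by rintro ⟨x⟩ ⟨y⟩ ⟨z⟩; exact pdist_triangle v x y z
  nonempty := ⟨Quotient.mk _ ⟨![![1, 0], ![0, 1]], 0, by simp [wedge]⟩⟩
  geodesic := by
    rintro ⟨x⟩ ⟨y⟩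
    obtain ⟨e, f, h, a, b, c, d, hx, hy⟩ := exists_common_apartment v x y
    have hpath : ∀ a b, pdist v (ofPair e f h (a - b) 0) (ofPair e f h a b) = 0 := fun a b => by
      rw [pdist_ofPair]; simp
    rcases le_total (a - b) (c - d) with hle | hle
    · refine ⟨a - b, c - d, hle, fun s => Quotient.mk _ (ofPair e f h s 0), ?_, ?_, ?_⟩
      · exact Quotient.sound ((pdist_congr_left v x (hpath a b)).trans hx)
      · exact Quotient.sound ((pdist_congr_left v y (hpath c d)).trans hy)
      · intro s _ t _
        change pdist v _ _ = _
        rw [pdist_ofPair]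
        simp
    -- the path along the apartment is run through in the opposite direction
    · refine ⟨-(a - b), -(c - d), neg_le_neg hle, fun s => Quotient.mk _ (ofPair e f h (-s) 0),
        ?_, ?_, ?_⟩
      · refine Quotient.sound (?_ : pdist v _ _ = 0)
        rw [neg_neg]
        exact (pdist_congr_left v x (hpath a b)).trans hx
      · refine Quotient.sound (?_ : pdist v _ _ = 0)
        rw [neg_neg]
        exact (pdist_congr_left v y (hpath c d)).trans hy
      · intro s _ t _
        change pdist v _ _ = _
        rw [pdist_ofPair, ← abs_neg (s - t)]
        congr 1
        abel
  hyperbolic := by rintro ⟨x⟩ ⟨y⟩ ⟨z⟩ ⟨t⟩; exact pdist_add_pdist_le v x y z t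
  even := by rintro ⟨x⟩ ⟨y⟩ ⟨z⟩; exact pdist_even v x y z

end WeightedTree

theorem zero_le_of_zero_le_mul_self (v : AddValuation K (WithTop Λ)) {a : K}
    (h : 0 ≤ v (a * a)) : 0 ≤ v a := by
  by_cases ha : a = 0
  · simp [ha]
  rw [AddValuation.map_mul, ← WeightedBasis.coe_val ha] at h
  rw [← WeightedBasis.coe_val ha]
  have h1 : (0 : Λ) ≤ WeightedBasis.val v a + WeightedBasis.val v a := by exact_mod_cast h
  have h2 : (0 : Λ) ≤ WeightedBasis.val v a := by grind
  exact_mod_cast h2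

/-- The trace of the square of an element of `SL₂` is `tr² - 2`. -/
theorem trace_sq_add_two (g : SL(2, K)) : (g ^ 2).1.trace + 2 = g.1.trace * g.1.trace := by
  have h := g.2
  rw [Matrix.det_fin_two] at h
  simp only [pow_two, Matrix.SpecialLinearGroup.coe_mul, Matrix.trace_fin_two, Matrix.mul_apply,
    Fin.sum_univ_two]
  linear_combination -2 * h

/-- Representations in `SL₂` for which the non-trivial elements have non-integral traces yield free
actions on trees. -/
theorem actsFreelyOnTree_of_trace {K : Type} [Field K] {Λ : Type} [AddCommGroup Λ] [LinearOrder Λ]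
    [IsOrderedAddMonoid Λ] (v : AddValuation K (WithTop Λ)) {G : Type*} [Group G]
    (j : G →* SL(2, K)) (hj : ∀ g, g ≠ 1 → ¬ 0 ≤ v (j g).1.trace) :
    ActsFreelyOnTree Λ G := by
  let _ : MulAction G (WeightedTree v) := MulAction.compHom _ j
  refine ⟨WeightedTree v, WeightedTree.tdist, MulAction.compHom _ j, WeightedTree.isLambdaTree,
    fun g x y => WeightedTree.tdist_smul (j g) x y,
    fun g hg x h => hj g hg (WeightedTree.zero_le_trace_of_smul_eq h), ?_⟩
  rintro g ⟨x, hx⟩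
  -- if the square of `g` has integral trace, so has `g`
  have h2 : 0 ≤ v (j (g ^ 2)).1.trace := WeightedTree.zero_le_trace_of_smul_eq hx
  have hg : g = 1 := by
    by_contra hg
    have h := hj g hg
    apply h
    have hsq : 0 ≤ v ((j g).1.trace * (j g).1.trace) := by
      rw [← trace_sq_add_two, ← map_pow]
      refine (le_min h2 ?_).trans (v.map_add _ _)
      exact ofNat_mem (valRing v) 2
    exact zero_le_of_zero_le_mul_self v hsq
  subst hg
  exact ⟨x, one_smul G x⟩

end WeightedBases

/-! ### Elements of `SL₂(K)` fixing a point of the Bruhat–Tits tree -/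

section FixedPoints

variable {K : Type u} [Field K] {Λ : Type v} [AddCommGroup Λ] [LinearOrder Λ] [IsOrderedAddMonoid Λ]
variable {v : AddValuation K (WithTop Λ)}

theorem wedge_cramer (e f x : Fin 2 → K) :
    wedge e f • x = wedge x f • e + wedge e x • f := by
  funext i
  fin_cases i <;> simp [wedge] <;> ring

theorem eq_smul_add_smul {e f : Fin 2 → K} (h : wedge e f ≠ 0) (x : Fin 2 → K) :
    x = (wedge x f / wedge e f) • e + (wedge e x / wedge e f) • f := by
  have := congrArg ((wedge e f)⁻¹ • ·) (wedge_cramer e f x)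
  simp only [smul_smul, inv_mul_cancel₀ h, one_smul, smul_add] at this
  rw [this]
  simp only [div_eq_inv_mul]
  congr 2 <;> rw [← this]

theorem mem_span_pair_iff {e f x : Fin 2 → K} :
    x ∈ Submodule.span (valRing v) {e, f} ↔
      ∃ a ∈ valRing v, ∃ b ∈ valRing v, a • e + b • f = x := by
  rw [Submodule.mem_span_pair]
  constructor
  · rintro ⟨a, b, h⟩
    exact ⟨a.1, a.2, b.1, b.2, h⟩
  · rintro ⟨a, ha, b, hb, h⟩
    exact ⟨⟨a, ha⟩, ⟨b, hb⟩, h⟩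

/-- The lattice spanned by two independent vectors. -/
def ValLattice.ofPair (v : AddValuation K (WithTop Λ)) (e f : Fin 2 → K) (h : wedge e f ≠ 0) :
    ValLattice v :=
  ⟨Submodule.span (valRing v) {e, f}, Submodule.fg_span (Set.toFinite _), by
    rw [Submodule.span_span_of_tower, eq_top_iff]
    intro x _
    exact Submodule.mem_span_pair.2 ⟨_, _, (eq_smul_add_smul h x).symm⟩⟩

/-- The vertex of a lattice. -/
def BruhatTitsTree.mk (L : ValLattice v) : BruhatTitsTree v := Quotient.mk _ L

theorem smul_mk_eq_mk_of_maps {g : SL(2, K)} {L : ValLattice v}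
    (h : ∀ x ∈ L.1, g.1.mulVec x ∈ L.1) (h' : ∀ x ∈ L.1, g⁻¹.1.mulVec x ∈ L.1) :
    g • BruhatTitsTree.mk L = BruhatTitsTree.mk L := by
  refine congrArg (Quotient.mk _) (ValLattice.ext' fun x => ?_)
  rw [ValLattice.mem_map]
  constructor
  · rintro ⟨y, hy, rfl⟩
    exact h y hy
  · intro hx
    refine ⟨_, h' x hx, ?_⟩
    change g.1.mulVec (g⁻¹.1.mulVec x) = x
    rw [Matrix.mulVec_mulVec, ← Matrix.SpecialLinearGroup.coe_mul, mul_inv_cancel,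
      Matrix.SpecialLinearGroup.coe_one, Matrix.one_mulVec]

/-- The Cayley–Hamilton identity for an element of `SL₂(K)`. -/
theorem mulVec_add_inv_mulVec (g : SL(2, K)) (x : Fin 2 → K) :
    g.1.mulVec x + g⁻¹.1.mulVec x = g.1.trace • x := by
  rw [Matrix.SpecialLinearGroup.coe_inv, Matrix.adjugate_fin_two]
  funext i
  fin_cases i <;> simp [dotProduct, Matrix.trace_fin_two] <;> ring

/-- An element of integral trace which is not scalar is a companion matrix in a suitable basis, so
it preserves a lattice. -/
theorem exists_smul_eq_of_zero_le_trace {g : SL(2, K)} (h : 0 ≤ v g.1.trace) :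
    ∃ x : BruhatTitsTree v, g • x = x := by
  by_cases hg : ∃ e, wedge e (g.1.mulVec e) ≠ 0
  · obtain ⟨e, he⟩ := hg
    refine ⟨.mk (ValLattice.ofPair v e (g.1.mulVec e) he), smul_mk_eq_mk_of_maps ?_ ?_⟩
    · intro x hx
      obtain ⟨a, ha, b, hb, rfl⟩ := mem_span_pair_iff.1 hx
      refine mem_span_pair_iff.2 ⟨-b, neg_mem hb, a + b * g.1.trace, add_mem ha (mul_mem hb h), ?_⟩
      have := mulVec_add_inv_mulVec g (g.1.mulVec e)
      rw [Matrix.mulVec_mulVec, Matrix.mulVec_mulVec, ← Matrix.SpecialLinearGroup.coe_mul g⁻¹,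
        inv_mul_cancel, Matrix.SpecialLinearGroup.coe_one, Matrix.one_mulVec] at this
      rw [Matrix.mulVec_add, Matrix.mulVec_smul, Matrix.mulVec_smul, Matrix.mulVec_mulVec,
        eq_sub_of_add_eq this]
      module
    · intro x hx
      obtain ⟨a, ha, b, hb, rfl⟩ := mem_span_pair_iff.1 hx
      refine mem_span_pair_iff.2 ⟨a * g.1.trace + b, add_mem (mul_mem ha h) hb, -a, neg_mem ha, ?_⟩
      have := mulVec_add_inv_mulVec g e
      rw [Matrix.mulVec_add, Matrix.mulVec_smul, Matrix.mulVec_smul, Matrix.mulVec_mulVec,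
        ← Matrix.SpecialLinearGroup.coe_mul, inv_mul_cancel, Matrix.SpecialLinearGroup.coe_one,
        Matrix.one_mulVec, ← sub_eq_of_eq_add' this.symm]
      module
  · push Not at hg
    -- every vector is an eigenvector, so `g` is scalar
    have h0 := hg ![1, 0]
    have h1 := hg ![0, 1]
    have h2 := hg ![1, 1]
    simp [wedge, Matrix.mulVec, dotProduct] at h0 h1 h2
    have h3 : g.1 1 1 = g.1 0 0 := by linear_combination h2 - h0 + h1
    have hc : g.1 0 0 ≠ 0 := by
      intro hc
      have := g.2
      rw [Matrix.det_fin_two, h0, hc] at this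
      simp at this
    refine ⟨.mk (ValLattice.ofPair v ![1, 0] ![0, 1] (by simp [wedge])), ?_⟩
    refine Quotient.sound (Setoid.symm ⟨Units.mk0 _ hc, ValLattice.ext' fun x => ?_⟩)
    rw [ValLattice.mem_map, ValLattice.mem_map]
    refine exists_congr fun y => and_congr_right fun _ => ?_
    have : g.1.mulVec y = g.1 0 0 • y := by
      funext i
      fin_cases i <;> simp [Matrix.mulVec, dotProduct, h0, h1, h3]
    change g.1.mulVec y = x ↔ g.1 0 0 • y = x
    rw [this]

theorem wedge_eq_zero_of_mem_span {S : Set (Fin 2 → K)} (h : ∀ s ∈ S, ∀ t ∈ S, wedge s t = 0)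
    {x y : Fin 2 → K} (hx : x ∈ Submodule.span K S) (hy : y ∈ Submodule.span K S) :
    wedge x y = 0 := by
  have hadd : ∀ a b c : Fin 2 → K, wedge (a + b) c = wedge a c + wedge b c := fun a b c => by
    simp only [wedge, Pi.add_apply]; ring
  have hsmul : ∀ (r : K) (a c : Fin 2 → K), wedge (r • a) c = r * wedge a c := fun r a c => by
    simp only [wedge, Pi.smul_apply, smul_eq_mul]; ring
  have key : ∀ t ∈ S, wedge x t = 0 := by
    intro t ht
    induction hx using Submodule.span_induction with
    | mem s hs => exact h s hs t ht
    | zero => simp [wedge]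
    | add a b _ _ ha hb => rw [hadd, ha, hb, add_zero]
    | smul r a _ ha => rw [hsmul, ha, mul_zero]
  rw [wedge_swap, neg_eq_zero]
  induction hy using Submodule.span_induction with
  | mem s hs => rw [wedge_swap, key s hs, neg_zero]
  | zero => simp [wedge]
  | add a b _ _ ha hb => rw [hadd, ha, hb, add_zero]
  | smul r a _ ha => rw [hsmul, ha, mul_zero]

/-- Lattices of the plane are free: two generators whose determinant has the least valuation form a
basis. -/
theorem ValLattice.exists_eq_ofPair (L : ValLattice v) :
    ∃ (e f : Fin 2 → K) (h : wedge e f ≠ 0), L = ValLattice.ofPair v e f h := by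
  classical
  obtain ⟨L, ⟨S, rfl⟩, hspan⟩ := L
  rw [Submodule.span_span_of_tower] at hspan
  let P : Finset ((Fin 2 → K) × (Fin 2 → K)) := (S ×ˢ S).filter fun p => wedge p.1 p.2 ≠ 0
  have hP : P.Nonempty := by
    by_contra hP
    have h0 : ∀ s ∈ (S : Set (Fin 2 → K)), ∀ t ∈ (S : Set (Fin 2 → K)), wedge s t = 0 := by
      intro s hs t ht
      by_contra hst
      exact hP ⟨(s, t), by simpa [P, hst] using ⟨hs, ht⟩⟩
    have := wedge_eq_zero_of_mem_span h0 (x := ![1, 0]) (y := ![0, 1])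
      (by rw [hspan]; trivial) (by rw [hspan]; trivial)
    simp [wedge] at this
  obtain ⟨⟨e, f⟩, hp, hmin⟩ := P.exists_min_image (fun p => v (wedge p.1 p.2)) hP
  simp only [P, Finset.mem_filter, Finset.mem_product] at hp hmin
  have hdiv : ∀ s ∈ S, ∀ t ∈ S, wedge s t / wedge e f ∈ valRing v := by
    intro s hs t ht
    by_cases hst : wedge s t = 0
    · rw [hst, zero_div]
      exact zero_mem _
    · have h1 := hmin (s, t) ⟨⟨hs, ht⟩, hst⟩
      change 0 ≤ v _
      have h2 : v (wedge s t) = v (wedge s t / wedge e f) + v (wedge e f) := by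
        rw [← AddValuation.map_mul, div_mul_cancel₀ _ hp.2]
      have h3 : wedge s t / wedge e f ≠ 0 := div_ne_zero hst hp.2
      rw [h2, ← WeightedBasis.coe_val hp.2, ← WeightedBasis.coe_val h3] at h1
      rw [← WeightedBasis.coe_val h3]
      have h4 : WeightedBasis.val v (wedge e f) ≤
        WeightedBasis.val v (wedge s t / wedge e f) + WeightedBasis.val v (wedge e f) := by
        exact_mod_cast h1
      have h5 : 0 ≤ WeightedBasis.val v (wedge s t / wedge e f) := by grind
      exact_mod_cast h5
  refine ⟨e, f, hp.2, Subtype.ext (le_antisymm ?_ ?_)⟩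
  · refine Submodule.span_le.2 fun s hs => mem_span_pair_iff.2 ⟨_, hdiv s hs f hp.1.2, _,
      hdiv e hp.1.1 s hs, (eq_smul_add_smul hp.2 s).symm⟩
  · refine Submodule.span_mono ?_
    rintro x (rfl | rfl)
    · exact hp.1.1
    · exact hp.1.2

/-- A matrix which preserves a lattice has integral trace and determinant. -/
theorem trace_mem_and_det_mem_of_maps {M : Matrix (Fin 2) (Fin 2) K} {L : ValLattice v}
    (h : ∀ x ∈ L.1, M.mulVec x ∈ L.1) : M.trace ∈ valRing v ∧ M.det ∈ valRing v := by
  obtain ⟨e, f, hef, rfl⟩ := L.exists_eq_ofPair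
  obtain ⟨a, ha, b, hb, h1⟩ := mem_span_pair_iff.1 (h e (Submodule.subset_span (by simp)))
  obtain ⟨c, hc, d, hd, h2⟩ := mem_span_pair_iff.1 (h f (Submodule.subset_span (by simp)))
  have htr : M.trace * wedge e f = wedge (M.mulVec e) f + wedge e (M.mulVec f) := by
    simp only [wedge, Matrix.trace_fin_two, Matrix.mulVec, dotProduct, Fin.sum_univ_two]
    ring
  have hdet : M.det * wedge e f = wedge (M.mulVec e) (M.mulVec f) := by
    simp only [wedge, Matrix.det_fin_two, Matrix.mulVec, dotProduct, Fin.sum_univ_two]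
    ring
  have e1 : M.trace = a + d := by
    refine mul_right_cancel₀ hef (htr.trans ?_)
    rw [← h1, ← h2]
    simp only [wedge, Pi.add_apply, Pi.smul_apply, smul_eq_mul]
    ring
  have e2 : M.det = a * d - b * c := by
    refine mul_right_cancel₀ hef (hdet.trans ?_)
    rw [← h1, ← h2]
    simp only [wedge, Pi.add_apply, Pi.smul_apply, smul_eq_mul]
    ring
  rw [e1, e2]
  exact ⟨add_mem ha hd, sub_mem (mul_mem ha hd) (mul_mem hb hc)⟩

/-- An element of `SL₂(K)` fixing a point of the Bruhat–Tits tree has integral trace. -/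
theorem zero_le_trace_of_smul_eq {g : SL(2, K)} {x : BruhatTitsTree v} (h : g • x = x) :
    0 ≤ v g.1.trace := by
  induction x using Quotient.inductionOn with
  | _ L =>
    obtain ⟨c, hc⟩ := Quotient.exact h
    have hmem : ∀ x, x ∈ L.1 ↔ ∃ y ∈ L.1, (c : K) • g.1.mulVec y = x := by
      intro x
      conv_lhs => rw [hc]
      rw [ValLattice.mem_map]
      constructor
      · rintro ⟨y, hy, rfl⟩
        obtain ⟨z, hz, rfl⟩ := ValLattice.mem_map.1 hy
        exact ⟨z, hz, rfl⟩
      · rintro ⟨y, hy, rfl⟩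
        exact ⟨_, ValLattice.mem_map.2 ⟨y, hy, rfl⟩, rfl⟩
    have h1 : ∀ x ∈ L.1, ((c : K) • g.1).mulVec x ∈ L.1 := fun x hx => by
      rw [Matrix.smul_mulVec]
      exact (hmem _).2 ⟨x, hx, rfl⟩
    have h2 : ∀ x ∈ L.1, (((c⁻¹ : Kˣ) : K) • g⁻¹.1).mulVec x ∈ L.1 := fun x hx => by
      obtain ⟨y, hy, rfl⟩ := (hmem x).1 hx
      rw [Matrix.smul_mulVec, Matrix.mulVec_smul, Matrix.mulVec_mulVec,
        ← Matrix.SpecialLinearGroup.coe_mul, inv_mul_cancel, Matrix.SpecialLinearGroup.coe_one,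
        Matrix.one_mulVec, smul_smul, ← Units.val_mul, inv_mul_cancel, Units.val_one, one_smul]
      exact hy
    -- the homothety factor is a unit, by the determinants
    have h3 := (trace_mem_and_det_mem_of_maps h2).2
    rw [Matrix.det_smul, g⁻¹.2, mul_one, Fintype.card_fin, pow_two] at h3
    have h4 : ((c⁻¹ : Kˣ) : K) ∈ valRing v := zero_le_of_zero_le_mul_self v h3
    have h5 := mul_mem h4 (trace_mem_and_det_mem_of_maps h1).1
    rwa [Matrix.trace_smul, smul_eq_mul, ← mul_assoc, ← Units.val_mul, inv_mul_cancel,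
      Units.val_one, one_mul] at h5

end FixedPoints

/-! ### Valuation rings and additive valuations -/

section AdditiveValuations

variable {K : Type*} [Field K]

/-- The valuation ring of a valuation, as a valuation subring of the field. -/
def AddValuation.toValuationSubring {Λ : Type*} [AddCommGroup Λ] [LinearOrder Λ]
    [IsOrderedAddMonoid Λ] (v : AddValuation K (WithTop Λ)) : ValuationSubring K :=
  ValuationSubring.ofSubring (valRing v) fun x => by
    by_cases hx : x = 0
    · exact Or.inl (hx ▸ zero_mem _)
    have hx' := inv_ne_zero hx
    have h := WeightedBasis.val_mul v hx hx'
    rw [mul_inv_cancel₀ hx] at h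
    have h1 : WeightedBasis.val v (1 : K) = 0 := by simp [WeightedBasis.val]
    change 0 ≤ v x ∨ 0 ≤ v x⁻¹
    rw [← WeightedBasis.coe_val hx, ← WeightedBasis.coe_val hx']
    rcases le_total 0 (WeightedBasis.val v x) with hle | hle
    · exact Or.inl (by exact_mod_cast hle)
    · have : 0 ≤ WeightedBasis.val v x⁻¹ := by grind
      exact Or.inr (by exact_mod_cast this)

theorem AddValuation.mem_toValuationSubring {Λ : Type*} [AddCommGroup Λ] [LinearOrder Λ]
    [IsOrderedAddMonoid Λ] {v : AddValuation K (WithTop Λ)} {x : K} :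
    x ∈ v.toValuationSubring ↔ 0 ≤ v x := Iff.rfl

namespace ValuationSubring

variable (A : ValuationSubring K)

/-- The value group of a valuation ring in additive notation, ordered so that the elements of the
valuation ring have non-negative valuations. -/
abbrev AddValueGroup : Type _ := Additive (A.ValueGroupˣ)ᵒᵈ

/-- The valuation of a non-zero element in the additive value group. -/
noncomputable def unitVal {x : K} (hx : x ≠ 0) : A.AddValueGroup :=
  Additive.ofMul (OrderDual.toDual (Units.mk0 (A.valuation x) ((Valuation.ne_zero_iff _).2 hx)))

variable {A}

theorem unitVal_mul {x y : K} (hx : x ≠ 0) (hy : y ≠ 0) :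
    A.unitVal (mul_ne_zero hx hy) = A.unitVal hx + A.unitVal hy := by
  refine congrArg (fun z => Additive.ofMul (OrderDual.toDual z)) (Units.ext ?_)
  exact map_mul A.valuation x y

theorem unitVal_one : A.unitVal (one_ne_zero (α := K)) = 0 := by
  refine congrArg (fun z => Additive.ofMul (OrderDual.toDual z)) (Units.ext ?_)
  exact map_one A.valuation

theorem unitVal_le_unitVal {x y : K} (hx : x ≠ 0) (hy : y ≠ 0) :
    A.unitVal hx ≤ A.unitVal hy ↔ A.valuation y ≤ A.valuation x := Iff.rfl

theorem unitVal_eq_unitVal {x y : K} (hx : x ≠ 0) (hy : y ≠ 0) :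
    A.unitVal hx = A.unitVal hy ↔ A.valuation x = A.valuation y := by
  rw [le_antisymm_iff, unitVal_le_unitVal, unitVal_le_unitVal, ← le_antisymm_iff, eq_comm]

theorem zero_le_unitVal {x : K} (hx : x ≠ 0) : 0 ≤ A.unitVal hx ↔ x ∈ A := by
  rw [← unitVal_one, unitVal_le_unitVal, map_one, A.valuation_le_one_iff]

theorem exists_unitVal_eq (a : A.AddValueGroup) : ∃ (x : K) (hx : x ≠ 0), A.unitVal hx = a := by
  obtain ⟨x, hx⟩ := A.valuation_surjective (OrderDual.ofDual a.toMul).1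
  have hx0 : x ≠ 0 := by
    rintro rfl
    exact (OrderDual.ofDual a.toMul).ne_zero (by rw [← hx, map_zero])
  exact ⟨x, hx0, congrArg (fun z => Additive.ofMul (OrderDual.toDual z)) (Units.ext hx)⟩

variable {Λ : Type*} [AddCommGroup Λ] [LinearOrder Λ] [IsOrderedAddMonoid Λ]

open Classical in
/-- The additive valuation of a valuation ring whose value group is embedded in an ordered group. -/
noncomputable def addValuation (φ : A.AddValueGroup →+ Λ) (hφ : StrictMono φ) :
    AddValuation K (WithTop Λ) :=
  AddValuation.of (fun x => if hx : x = 0 then ⊤ else (φ (A.unitVal hx) : Λ))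
    (by simp)
    (by simp [unitVal_one])
    (fun x y => by
      by_cases hx : x = 0
      · simp [hx]
      by_cases hy : y = 0
      · simp [hy]
      by_cases hxy : x + y = 0
      · simp [hxy]
      simp only [hx, hy, hxy, dite_false, min_le_iff, WithTop.coe_le_coe, hφ.le_iff_le,
        unitVal_le_unitVal]
      exact le_max_iff.1 (A.valuation.map_add x y))
    (fun x y => by
      by_cases hx : x = 0
      · simp [hx]
      by_cases hy : y = 0
      · simp [hy]
      simp only [hx, hy, mul_eq_zero, or_self, dite_false]
      rw [unitVal_mul hx hy, map_add, WithTop.coe_add])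

theorem zero_le_addValuation_iff {φ : A.AddValueGroup →+ Λ} {hφ : StrictMono φ} {x : K} :
    0 ≤ addValuation φ hφ x ↔ x ∈ A := by
  classical
  rw [addValuation, AddValuation.of_apply]
  by_cases hx : x = 0
  · simp [hx]
  · simp only [hx, dite_false]
    rw [← zero_le_unitVal hx, ← hφ.le_iff_le, map_zero]
    norm_cast

end ValuationSubring

end AdditiveValuations

/-! ### Reduction to finitely generated fields -/

section FreeTraces

/-- A representation `j` in `SL₂` of a valued field such that the traces of the non-trivial elements
lie outside of the valuation ring. -/
def HasFreeTrace {K : Type*} [Field K] (A : ValuationSubring K) {G : Type*} [Group G]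
    (j : G →* SL(2, K)) : Prop :=
  ∀ g, g ≠ 1 → (j g).1.trace ∉ A

instance {Λ : Type u} [AddCommGroup Λ] [LinearOrder Λ] [IsOrderedAddMonoid Λ] :
    IsOrderedAddMonoid (ULift.{v} Λ) where
  add_le_add_left a b h c := by
    change a.down + c.down ≤ b.down + c.down
    exact add_le_add_left (a := c.down) (show a.down ≤ b.down from h)

theorem trace_map {R S : Type*} [CommRing R] [CommRing S] (f : R →+* S) (g : SL(2, R)) :
    (Matrix.SpecialLinearGroup.map f g).1.trace = f g.1.trace := by
  simp [Matrix.trace_fin_two]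

theorem HasFreeTrace.hasFreeBruhatTitsAction {K : Type} [Field K] {A : ValuationSubring K}
    {G : Type w} [Group G] {j : G →* SL(2, K)} (h : HasFreeTrace A j) :
    HasFreeBruhatTitsAction.{w, u, v} G := by
  let φ : A.AddValueGroup →+ ULift.{v} A.AddValueGroup := AddEquiv.ulift.symm.toAddMonoidHom
  have hφ : StrictMono φ := fun a b hab => hab
  let f : ULift.{u} K ≃+* K := ULift.ringEquiv
  refine ⟨ULift.{u} K, inferInstance, ULift.{v} A.AddValueGroup, inferInstance, inferInstance,
    inferInstance, (ValuationSubring.addValuation φ hφ).comap f.toRingHom,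
    (Matrix.SpecialLinearGroup.map f.symm.toRingHom).comp j, fun g hg x hx => h g hg ?_⟩
  have := zero_le_trace_of_smul_eq hx
  rw [MonoidHom.comp_apply, trace_map] at this
  exact (ValuationSubring.zero_le_addValuation_iff (hφ := hφ)).1 this

/-- The field generated by the coefficients of an element of `SL₂(K)` is generated by three
elements, as the determinant allows to recover one of the coefficients. -/
theorem exists_three_generators {K : Type*} [Field K] (g : SL(2, K)) :
    ∃ p : Fin 3 → K, ∀ F : Subfield K, (∀ k, p k ∈ F) → ∀ a b, g.1 a b ∈ F := by
  have h := g.2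
  rw [Matrix.det_fin_two] at h
  by_cases h0 : g.1 0 0 = 0
  · have hne : g.1 0 1 ≠ 0 := by
      intro h1
      rw [h0, h1] at h
      simp at h
    refine ⟨![0, g.1 0 1, g.1 1 1], fun F hF a b => ?_⟩
    have h1 : g.1 0 1 ∈ F := hF 1
    have h2 : g.1 1 1 ∈ F := hF 2
    have h3 : g.1 1 0 = -(g.1 0 1)⁻¹ := by
      rw [h0] at h
      field_simp
      linear_combination -h
    fin_cases a <;> fin_cases b <;> simp [h0, h1, h2, h3]
  · refine ⟨![g.1 0 0, g.1 0 1, g.1 1 0], fun F hF a b => ?_⟩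
    have h1 : g.1 0 0 ∈ F := hF 0
    have h2 : g.1 0 1 ∈ F := hF 1
    have h3 : g.1 1 0 ∈ F := hF 2
    have h4 : g.1 1 1 = (1 + g.1 0 1 * g.1 1 0) / g.1 0 0 := by
      field_simp
      linear_combination h
    fin_cases a <;> fin_cases b <;> simp [h1, h2, h3]
    rw [h4]
    exact div_mem (add_mem (one_mem _) (mul_mem h2 h3)) h1

/-- The restriction to a subfield of a representation with coefficients in this subfield. -/
def restrictSubfield {K : Type*} [Field K] {G : Type*} [Group G] (j : G →* SL(2, K))
    (F : Subfield K) (h : ∀ g a b, (j g).1 a b ∈ F) : G →* SL(2, F) where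
  toFun g := ⟨Matrix.of fun a b => ⟨(j g).1 a b, h g a b⟩, by
    have := (j g).2
    rw [Matrix.det_fin_two] at this ⊢
    exact Subtype.ext this⟩
  map_one' := by
    ext a b
    simp only [map_one]
    fin_cases a <;> fin_cases b <;> simp
  map_mul' x y := by
    ext a b
    change (j (x * y)).1 a b = F.subtype ((Matrix.of (fun a b => (⟨(j x).1 a b, h x a b⟩ : F)) *
      Matrix.of fun a b => (⟨(j y).1 a b, h y a b⟩ : F)) a b)
    simp [Matrix.mul_apply]

theorem coe_restrictSubfield {K : Type*} [Field K] {G : Type*} [Group G] (j : G →* SL(2, K))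
    (F : Subfield K) (h : ∀ g a b, (j g).1 a b ∈ F) (g : G) (a b : Fin 2) :
    ((restrictSubfield j F h g).1 a b : K) = (j g).1 a b := rfl

/-- A group having a free action on a Bruhat–Tits tree and generated by `n` elements has one over
a field generated by `3 n` elements. -/
theorem exists_hasFreeTrace {G : Type w} [Group G] (h : HasFreeBruhatTitsAction.{w, u, v} G)
    {n : ℕ} {gen : Fin n → G} (hgen : Subgroup.closure (Set.range gen) = ⊤) :
    ∃ (K : Type) (_ : Field K) (A : ValuationSubring K) (j : G →* SL(2, K))
      (q : Fin n × Fin 3 → K), Subfield.closure (Set.range q) = ⊤ ∧ HasFreeTrace A j := by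
  obtain ⟨K, _, Λ, _, _, _, v, j, hj⟩ := h
  choose p hp using fun i => exists_three_generators (j (gen i))
  let F := Subfield.closure (Set.range fun ik : Fin n × Fin 3 => p ik.1 ik.2)
  have hq : ∀ i k, p i k ∈ F := fun i k => Subfield.subset_closure ⟨(i, k), rfl⟩
  have hF : ∀ g a b, (j g).1 a b ∈ F := by
    intro g
    have hg : g ∈ Subgroup.closure (Set.range gen) := hgen ▸ Subgroup.mem_top g
    induction hg using Subgroup.closure_induction with
    | mem x hx =>
      obtain ⟨i, rfl⟩ := hx
      exact hp i F (hq i)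
    | one =>
      intro a b
      rw [map_one, Matrix.SpecialLinearGroup.coe_one]
      fin_cases a <;> fin_cases b <;> simp
    | mul x y _ _ hx hy =>
      intro a b
      rw [map_mul, Matrix.SpecialLinearGroup.coe_mul, Matrix.mul_apply]
      exact sum_mem fun i _ => mul_mem (hx a i) (hy i b)
    | inv x _ hx =>
      intro a b
      rw [map_inv, Matrix.SpecialLinearGroup.coe_inv, Matrix.adjugate_fin_two]
      fin_cases a <;> fin_cases b <;> simp [hx]
  have : Countable F := by
    rw [← Cardinal.mk_le_aleph0_iff]
    refine (Subfield.cardinalMk_closure_le_max _).trans (max_le ?_ le_rfl)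
    exact Cardinal.mk_le_aleph0_iff.2 (Set.countable_range _).to_subtype
  let e : Shrink.{0} F ≃+* F := Shrink.ringEquiv.{0} F
  let f : Shrink.{0} F →+* K := F.subtype.comp e.toRingHom
  refine ⟨Shrink.{0} F, inferInstance, v.toValuationSubring.comap f,
    (Matrix.SpecialLinearGroup.map e.symm.toRingHom).comp (restrictSubfield j F hF),
    fun ik => e.symm ⟨p ik.1 ik.2, hq _ _⟩, ?_, fun g hg hmem => ?_⟩
  · rw [eq_top_iff]
    intro x _
    have hx : f x ∈ (Subfield.closure (Set.range fun ik : Fin n × Fin 3 =>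
        e.symm ⟨p ik.1 ik.2, hq _ _⟩)).map f := by
      rw [RingHom.map_field_closure, ← Set.range_comp]
      convert (e x).2 using 3
      · funext ik
        simp [f]
      · rfl
    obtain ⟨y, hy, hxy⟩ := Subfield.mem_map.1 hx
    rwa [f.injective hxy] at hy
  · have h1 : (j g).1.trace ∈ v.toValuationSubring := by
      rw [MonoidHom.comp_apply, trace_map] at hmem
      have h2 : f (e.symm.toRingHom (restrictSubfield j F hF g).1.trace) = (j g).1.trace := by
        simp [f, Matrix.trace_fin_two, coe_restrictSubfield]
      rw [← h2]
      exact hmem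
    obtain ⟨x, hx⟩ := exists_smul_eq_of_zero_le_trace (AddValuation.mem_toValuationSubring.1 h1)
    exact hj g hg x hx

end FreeTraces

/-! ### Ultraproducts of valued fields -/

section Ultraproducts

variable {ι : Type} (U : Ultrafilter ι) (K : ι → Type) [∀ i, Field (K i)]

/-- The ideal of the product of the fields `K i` whose quotient is their ultraproduct. -/
def ultraIdeal : Ideal (∀ i, K i) where
  carrier := {f | ∀ᶠ i in U, f i = 0}
  add_mem' {f g} hf hg := by
    filter_upwards [hf, hg] with i h1 h2
    rw [Pi.add_apply, h1, h2, add_zero]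
  zero_mem' := Filter.Eventually.of_forall fun _ => rfl
  smul_mem' c f hf := by
    filter_upwards [hf] with i h
    rw [smul_eq_mul, Pi.mul_apply, h, mul_zero]

theorem mem_ultraIdeal {f : ∀ i, K i} : f ∈ ultraIdeal U K ↔ ∀ᶠ i in U, f i = 0 := Iff.rfl

instance : (ultraIdeal U K).IsMaximal := by
  classical
  rw [Ideal.isMaximal_iff]
  refine ⟨fun h => ?_, fun J f hJ hf hfJ => ?_⟩
  · obtain ⟨i, hi⟩ := ((mem_ultraIdeal U K).1 h).exists
    exact one_ne_zero hi
  · -- `1 - f * f⁻¹` vanishes where `f` does not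
    have h1 : 1 - f⁻¹ * f ∈ ultraIdeal U K := by
      rw [mem_ultraIdeal] at hf ⊢
      filter_upwards [Ultrafilter.eventually_not.2 hf] with i hi
      simp [inv_mul_cancel₀ hi]
    have h2 := J.add_mem (hJ h1) (J.mul_mem_left f⁻¹ hfJ)
    rwa [sub_add_cancel] at h2

/-- The ultraproduct of the fields `K i`. -/
abbrev UltraField : Type := (∀ i, K i) ⧸ ultraIdeal U K

noncomputable instance : Field (UltraField U K) := Ideal.Quotient.field _

variable {K} (A : ∀ i, ValuationSubring (K i))

/-- The ultraproduct of the valuation rings `A i`. -/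
def ultraValuationSubring : ValuationSubring (UltraField U K) where
  carrier := {x | ∃ f, Ideal.Quotient.mk _ f = x ∧ ∀ᶠ i in U, f i ∈ A i}
  mul_mem' := by
    rintro _ _ ⟨f, rfl, hf⟩ ⟨g, rfl, hg⟩
    refine ⟨f * g, map_mul _ _ _, ?_⟩
    filter_upwards [hf, hg] with i h1 h2 using mul_mem h1 h2
  one_mem' := ⟨1, map_one _, Filter.Eventually.of_forall fun i => one_mem (A i)⟩
  add_mem' := by
    rintro _ _ ⟨f, rfl, hf⟩ ⟨g, rfl, hg⟩
    refine ⟨f + g, map_add _ _ _, ?_⟩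
    filter_upwards [hf, hg] with i h1 h2 using add_mem h1 h2
  zero_mem' := ⟨0, map_zero _, Filter.Eventually.of_forall fun i => zero_mem (A i)⟩
  neg_mem' := by
    rintro _ ⟨f, rfl, hf⟩
    refine ⟨-f, map_neg _ _, ?_⟩
    filter_upwards [hf] with i h using neg_mem h
  mem_or_inv_mem' x := by
    obtain ⟨f, rfl⟩ := Ideal.Quotient.mk_surjective x
    by_cases hf : f ∈ ultraIdeal U K
    · rw [Ideal.Quotient.eq_zero_iff_mem.2 hf]
      exact Or.inl ⟨0, map_zero _, Filter.Eventually.of_forall fun i => zero_mem (A i)⟩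
    have hinv : (Ideal.Quotient.mk (ultraIdeal U K) f)⁻¹ = Ideal.Quotient.mk _ f⁻¹ := by
      refine inv_eq_of_mul_eq_one_right ?_
      rw [← map_mul, ← map_one (Ideal.Quotient.mk _), Ideal.Quotient.eq, mem_ultraIdeal]
      filter_upwards [Ultrafilter.eventually_not.2 hf] with i hi
      simp [mul_inv_cancel₀ hi]
    have h : ∀ᶠ i in U, f i ∈ A i ∨ f⁻¹ i ∈ A i :=
      Filter.Eventually.of_forall fun i => (A i).mem_or_inv_mem (f i)
    rcases Ultrafilter.eventually_or.1 h with h | h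
    · exact Or.inl ⟨f, rfl, h⟩
    · exact Or.inr ⟨f⁻¹, hinv.symm, h⟩

theorem mk_mem_ultraValuationSubring {f : ∀ i, K i} :
    Ideal.Quotient.mk _ f ∈ ultraValuationSubring U A ↔ ∀ᶠ i in U, f i ∈ A i := by
  refine ⟨?_, fun h => ⟨f, rfl, h⟩⟩
  rintro ⟨g, hg, h⟩
  rw [Ideal.Quotient.eq, mem_ultraIdeal] at hg
  filter_upwards [hg, h] with i h1 h2
  rwa [← sub_eq_zero.1 h1]

variable {F : Type*} [Group F]

/-- A family of representations in `SL₂(K i)` as a representation over the product ring. -/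
def piRepresentation (J : ∀ i, F →* SL(2, K i)) : F →* SL(2, ∀ i, K i) where
  toFun w := ⟨Matrix.of fun a b i => (J i w).1 a b, by
    funext i
    have := (J i w).2
    rw [Matrix.det_fin_two] at this ⊢
    exact this⟩
  map_one' := by
    ext a b i
    fin_cases a <;> fin_cases b <;> simp
  map_mul' x y := by
    ext a b i
    change (J i (x * y)).1 a b = ((Matrix.of fun a b i => (J i x).1 a b : Matrix _ _ (∀ i, K i)) *
      Matrix.of fun a b i => (J i y).1 a b : Matrix _ _ (∀ i, K i)) a b i
    simp [Matrix.mul_apply]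

theorem piRepresentation_apply (J : ∀ i, F →* SL(2, K i)) (w : F) (a b : Fin 2) (i : ι) :
    (piRepresentation J w).1 a b i = (J i w).1 a b := rfl

/-- The ultraproduct of a family of representations in `SL₂`. -/
noncomputable def ultraRepresentation (J : ∀ i, F →* SL(2, K i)) : F →* SL(2, UltraField U K) :=
  (Matrix.SpecialLinearGroup.map (Ideal.Quotient.mk (ultraIdeal U K))).comp (piRepresentation J)

theorem ultraRepresentation_eq_one {J : ∀ i, F →* SL(2, K i)} {w : F}
    (h : ∀ᶠ i in U, J i w = 1) : ultraRepresentation U J w = 1 := by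
  ext a b
  rw [ultraRepresentation, MonoidHom.comp_apply, Matrix.SpecialLinearGroup.map_apply_coe,
    RingHom.mapMatrix_apply, Matrix.map_apply, Matrix.SpecialLinearGroup.coe_one,
    ← map_one (Ideal.Quotient.mk (ultraIdeal U K)).mapMatrix, RingHom.mapMatrix_apply,
    Matrix.map_apply, Ideal.Quotient.eq, mem_ultraIdeal]
  filter_upwards [h] with i hi
  rw [Pi.sub_apply, piRepresentation_apply, hi, Matrix.SpecialLinearGroup.coe_one]
  fin_cases a <;> fin_cases b <;> simp

theorem trace_ultraRepresentation_mem {J : ∀ i, F →* SL(2, K i)} {w : F} :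
    (ultraRepresentation U J w).1.trace ∈ ultraValuationSubring U A ↔
      ∀ᶠ i in U, (J i w).1.trace ∈ A i := by
  rw [ultraRepresentation, MonoidHom.comp_apply, trace_map, mk_mem_ultraValuationSubring]
  refine Filter.eventually_congr (Filter.Eventually.of_forall fun i => ?_)
  simp [Matrix.trace_fin_two, piRepresentation_apply]

end Ultraproducts

/-! ### Limits of marked groups -/

section Limits

theorem HasFreeBruhatTitsAction.of_mulEquiv {G H : Type w} [Group G] [Group H] (e : G ≃* H)
    (h : HasFreeBruhatTitsAction.{w, u, v} G) : HasFreeBruhatTitsAction.{w, u, v} H := by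
  obtain ⟨K, _, Λ, _, _, _, v, j, hj⟩ := h
  refine ⟨K, inferInstance, Λ, inferInstance, inferInstance, inferInstance, v,
    j.comp e.symm.toMonoidHom, fun g hg => hj (e.symm g) ?_⟩
  simpa using hg

theorem mk_mem_freeBruhatTitsSet_iff {n : ℕ} {A : MarkedGroup.{w} n} :
    MarkedGroupSpace.mk A ∈ freeBruhatTitsSet.{w, u, v} n ↔
      HasFreeBruhatTitsAction.{w, u, v} A.G := by
  refine ⟨?_, fun h => ⟨A, rfl, h⟩⟩
  rintro ⟨B, hB, h⟩
  obtain ⟨φ, _⟩ := Quotient.exact hB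
  exact h.of_mulEquiv φ

theorem MarkedGroup.lift_surjective {n : ℕ} (A : MarkedGroup.{w} n) :
    Function.Surjective (FreeGroup.lift A.gen) := by
  rw [← MonoidHom.range_eq_top, FreeGroup.range_lift_eq_closure, A.closure_gen]

/-- If the marked groups `B i` have the same relations as `A` on larger and larger balls, then the
ultraproduct of representations of the `B i` is a representation of `A`. -/
theorem hasFreeBruhatTitsAction_of_limit {n : ℕ} (A : MarkedGroup.{w} n) (B : ℕ → MarkedGroup.{w} n)
    (hB : ∀ i, HasFreeBruhatTitsAction.{w, u, v} (B i).G)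
    (hrel : ∀ i (r : FreeGroup (Fin n)), r.norm ≤ i → (r ∈ (B i).relations ↔ r ∈ A.relations)) :
    HasFreeBruhatTitsAction.{w, u, v} A.G := by
  choose K hK R j q _ hj using fun i => exists_hasFreeTrace (hB i) (B i).closure_gen
  let U : Ultrafilter ℕ := Filter.hyperfilter ℕ
  let J : ∀ i, FreeGroup (Fin n) →* SL(2, K i) := fun i => (j i).comp (FreeGroup.lift (B i).gen)
  have hev : ∀ r : FreeGroup (Fin n), ∀ᶠ i in U, r ∈ (B i).relations ↔ r ∈ A.relations := by
    intro r
    have : ∀ᶠ i in Filter.atTop, r ∈ (B i).relations ↔ r ∈ A.relations := by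
      filter_upwards [Filter.eventually_ge_atTop r.norm] with i hi using hrel i r hi
    exact Nat.hyperfilter_le_atTop this
  have hker : (FreeGroup.lift A.gen).ker ≤ (ultraRepresentation U J).ker := by
    intro r hr
    refine ultraRepresentation_eq_one U ?_
    filter_upwards [hev r] with i hi
    have h : FreeGroup.lift (B i).gen r = 1 := hi.2 hr
    simp only [J, MonoidHom.comp_apply, h, map_one]
  let ρ : A.G →* SL(2, UltraField U K) :=
    (FreeGroup.lift A.gen).liftOfSurjective A.lift_surjective ⟨ultraRepresentation U J, hker⟩
  have hρ : ∀ r, ρ (FreeGroup.lift A.gen r) = ultraRepresentation U J r := fun r =>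
    MonoidHom.liftOfRightInverse_comp_apply _ _ _ _ r
  refine HasFreeTrace.hasFreeBruhatTitsAction (A := ultraValuationSubring U R) (j := ρ) ?_
  intro g hg hmem
  obtain ⟨r, rfl⟩ := A.lift_surjective g
  rw [hρ, trace_ultraRepresentation_mem] at hmem
  obtain ⟨i, h1, h2⟩ := (hmem.and (hev r)).exists
  refine hj i _ (fun h => ?_) h1
  exact hg (h2.1 h)

/-- The set of marked groups having a free action on a Bruhat–Tits tree is closed. -/
theorem isClosed_freeBruhatTitsSet (n : ℕ) : IsClosed (freeBruhatTitsSet.{w, u, v} n) := by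
  rw [← isOpen_compl_iff]
  intro x hx
  by_contra! hcon
  induction x using Quotient.inductionOn with
  | _ A =>
    have h : ∀ R : ℕ, ∃ B : MarkedGroup.{w} n, HasFreeBruhatTitsAction.{w, u, v} B.G ∧
        ∀ r : FreeGroup (Fin n), r.norm ≤ R → (r ∈ B.relations ↔ r ∈ A.relations) := by
      intro R
      obtain ⟨y, hy, hy'⟩ := Set.not_subset.1 (hcon (R + 1) R.succ_pos)
      obtain ⟨B, rfl, hB⟩ := not_not.1 hy'
      exact ⟨B, hB, fun r hr => hy r (hr.trans R.le_succ)⟩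
    choose B hB hrel using h
    exact hx (mk_mem_freeBruhatTitsSet_iff.2 (hasFreeBruhatTitsAction_of_limit A B hB hrel))

end Limits

/-! ### The rank of the value group -/

section Rank

namespace ValuationSubring

variable {K : Type*} [Field K] (A : ValuationSubring K)

/-- The valuation as a homomorphism from the multiplicative group of the field. -/
noncomputable def valHom : Additive Kˣ →+ A.AddValueGroup where
  toFun x := A.unitVal x.toMul.ne_zero
  map_zero' := unitVal_one
  map_add' x y := unitVal_mul x.toMul.ne_zero y.toMul.ne_zero

variable {A}

theorem valHom_eq_iff {x y : Kˣ} : A.valHom (.ofMul x) = A.valHom (.ofMul y) ↔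
    A.valuation (x : K) = A.valuation (y : K) :=
  unitVal_eq_unitVal x.ne_zero y.ne_zero

theorem valHom_eq_zero_iff {x : Kˣ} : A.valHom (.ofMul x) = 0 ↔ A.valuation (x : K) = 1 := by
  rw [← map_zero A.valHom, ← ofMul_one, valHom_eq_iff, Units.val_one, map_one]

theorem valHom_surjective : Function.Surjective A.valHom := fun a => by
  obtain ⟨x, hx, rfl⟩ := exists_unitVal_eq a
  exact ⟨.ofMul (Units.mk0 x hx), rfl⟩

variable (A) in
/-- The valuation of the natural numbers has rank at most one: it is governed by the least positive
natural number which is not a unit of the valuation ring, if any. -/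
theorem exists_valHom_natCast_mem_span : ∃ a : A.AddValueGroup, ∀ (m : ℕ) (x : Kˣ),
    (x : K) = m → A.valHom (.ofMul x) ∈ Submodule.span ℤ {a} := by
  classical
  by_cases hex : ∃ p : ℕ, 0 < p ∧ A.valuation (p : K) < 1
  · let p := Nat.find hex
    have hp : 0 < p ∧ A.valuation (p : K) < 1 := Nat.find_spec hex
    have hmin : ∀ r : ℕ, 0 < r → r < p → A.valuation (r : K) = 1 := fun r hr hrp =>
      le_antisymm ((A.valuation_le_one_iff _).2 (natCast_mem A r))
        (not_lt.1 fun h => Nat.find_min hex hrp ⟨hr, h⟩)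
    refine ⟨if h : (p : K) = 0 then 0 else A.valHom (.ofMul (Units.mk0 _ h)), fun m => ?_⟩
    induction m using Nat.strong_induction_on with
    | _ m ih =>
      intro x hx
      have hm : (m : K) ≠ 0 := hx ▸ x.ne_zero
      have hm0 : 0 < m := Nat.pos_of_ne_zero fun h => hm (by rw [h, Nat.cast_zero])
      by_cases hdvd : p ∣ m
      · obtain ⟨t, rfl⟩ := hdvd
        rw [Nat.cast_mul] at hx hm
        have hp0 := left_ne_zero_of_mul hm
        have ht0 := right_ne_zero_of_mul hm
        have hp1 : p ≠ 1 := fun h => by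
          have := hp.2
          rw [h, Nat.cast_one, map_one] at this
          exact lt_irrefl _ this
        have hlt : t < p * t := by
          have : 0 < t := Nat.pos_of_mul_pos_left hm0
          have := hp.1
          nlinarith [show 2 ≤ p by omega]
        have hxe : x = Units.mk0 _ hp0 * Units.mk0 _ ht0 := Units.ext hx
        rw [hxe, ofMul_mul, map_add]
        refine Submodule.add_mem _ ?_ (ih t hlt (Units.mk0 _ ht0) rfl)
        rw [dif_neg hp0]
        exact Submodule.mem_span_singleton_self _
      · -- the remainder of the division by `p` is a unit, hence so is `m`
        have hr : 0 < m % p := Nat.pos_of_ne_zero fun h => hdvd (Nat.dvd_of_mod_eq_zero h)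
        have h1 := hmin _ hr (Nat.mod_lt _ hp.1)
        have h2 : A.valuation ((p : K) * (m / p : ℕ)) < A.valuation ((m % p : ℕ) : K) := by
          rw [h1, map_mul]
          exact mul_lt_one_of_lt_of_le hp.2
            ((A.valuation_le_one_iff _).2 (natCast_mem A _))
        have h3 := A.valuation.map_add_eq_of_lt_right h2
        rw [← Nat.cast_mul, ← Nat.cast_add, Nat.div_add_mod, h1, ← hx] at h3
        rw [valHom_eq_zero_iff.2 h3]
        exact Submodule.zero_mem _
  · push Not at hex
    refine ⟨0, fun m x hx => ?_⟩
    have hm0 : 0 < m := Nat.pos_of_ne_zero fun h => x.ne_zero (by rw [hx, h, Nat.cast_zero])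
    have h : A.valuation (x : K) = 1 := by
      rw [hx]
      exact le_antisymm ((A.valuation_le_one_iff _).2 (natCast_mem A m)) (hex m hm0)
    rw [valHom_eq_zero_iff.2 h]
    exact Submodule.zero_mem _

theorem valHom_intCast_mem {V : Submodule ℤ A.AddValueGroup}
    (hV : ∀ (m : ℕ) (x : Kˣ), (x : K) = m → A.valHom (.ofMul x) ∈ V) (m : ℤ) (x : Kˣ)
    (hx : (x : K) = m) : A.valHom (.ofMul x) ∈ V := by
  obtain ⟨k, rfl | rfl⟩ := m.eq_nat_or_neg
  · exact hV k x (by simpa using hx)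
  · have h : A.valHom (.ofMul x) = A.valHom (.ofMul (-x)) :=
      valHom_eq_iff.2 (by rw [Units.val_neg, Valuation.map_neg])
    rw [h]
    exact hV k (-x) (by rw [Units.val_neg, hx]; simp)

theorem valHom_monomial {ι : Type*} (y : ι → Kˣ)
    (V : Submodule ℤ A.AddValueGroup) (m : ι →₀ ℕ) (c x : Kˣ)
    (hc : A.valHom (.ofMul c) ∈ V) (hx : (x : K) = c * ∏ i ∈ m.support, (y i : K) ^ m i) :
    V.mkQ (A.valHom (.ofMul x)) = Finsupp.linearCombination ℤ
      (fun i => V.mkQ (A.valHom (.ofMul (y i)))) (m.mapRange (fun k : ℕ => (k : ℤ)) rfl) := by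
  have hxe : x = c * ∏ i ∈ m.support, y i ^ m i := Units.ext (by
    rw [hx, Units.val_mul, Units.coe_prod]
    simp)
  have hc0 : V.mkQ (A.valHom (.ofMul c)) = 0 := (Submodule.Quotient.mk_eq_zero V).2 hc
  rw [hxe, ofMul_mul, map_add, map_add, hc0, zero_add, ofMul_prod, map_sum, map_sum,
    Finsupp.linearCombination_apply,
    Finsupp.sum_mapRange_index (by simp)]
  refine Finset.sum_congr rfl fun i _ => ?_
  rw [ofMul_pow, map_nsmul, map_nsmul]
  exact (natCast_zsmul _ _).symm

/-- Elements whose valuations are independent modulo the valuations of the constants are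
algebraically independent, as distinct monomials have distinct valuations. -/
theorem algebraicIndependent_of_valHom {R : Type*} [CommRing R] [Algebra R K]
    [FaithfulSMul R K] {V : Submodule ℤ A.AddValueGroup}
    (hV : ∀ (r : R) (x : Kˣ), (x : K) = algebraMap R K r → A.valHom (.ofMul x) ∈ V)
    {ι : Type*} {y : ι → Kˣ}
    (hy : LinearIndependent ℤ fun i => V.mkQ (A.valHom (.ofMul (y i)))) :
    AlgebraicIndependent R fun i => (y i : K) := by
  classical
  rw [algebraicIndependent_iff]
  intro P hP
  by_contra hne
  have hc : ∀ m ∈ P.support, algebraMap R K (P.coeff m) ≠ 0 := fun m hm h =>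
    MvPolynomial.mem_support_iff.1 hm
      (FaithfulSMul.algebraMap_injective R K (h.trans (map_zero _).symm))
  let T : (ι →₀ ℕ) → K := fun m =>
    algebraMap R K (P.coeff m) * ∏ i ∈ m.support, (y i : K) ^ m i
  have hT : ∀ m ∈ P.support, T m ≠ 0 := fun m hm =>
    mul_ne_zero (hc m hm) (Finset.prod_ne_zero_iff.2 fun i _ => pow_ne_zero _ (y i).ne_zero)
  have hsum : ∑ m ∈ P.support, T m = 0 := by
    rw [← hP, MvPolynomial.aeval_def, MvPolynomial.eval₂_eq]
  have hinj : ∀ m ∈ P.support, ∀ m' ∈ P.support,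
      A.valuation (T m) = A.valuation (T m') → m = m' := by
    intro m hm m' hm' h
    have key : ∀ m (hm : m ∈ P.support), V.mkQ (A.valHom (.ofMul (Units.mk0 _ (hT m hm)))) =
        Finsupp.linearCombination ℤ (fun i => V.mkQ (A.valHom (.ofMul (y i))))
          (m.mapRange (fun k : ℕ => (k : ℤ)) rfl) := fun m hm =>
      valHom_monomial y V m (Units.mk0 _ (hc m hm)) _ (hV _ _ rfl) rfl
    have h' := (valHom_eq_iff (x := Units.mk0 _ (hT m hm)) (y := Units.mk0 _ (hT m' hm'))).2 h
    have := congrArg V.mkQ h'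
    rw [key m hm, key m' hm'] at this
    exact Finsupp.mapRange_injective _ rfl Nat.cast_injective
      (linearIndependent_iff_injective_finsuppLinearCombination.1 hy this)
  obtain ⟨j, hj, hmax⟩ := P.support.exists_max_image (fun m => A.valuation (T m))
    (MvPolynomial.support_nonempty.2 hne)
  have hv := A.valuation.map_sum_eq_of_lt hj (f := T) fun i hi => by
    rw [Finset.mem_sdiff, Finset.mem_singleton] at hi
    exact lt_of_le_of_ne (hmax i hi.1) fun h => hi.2 (hinj i hi.1 j hj h)
  rw [hsum, map_zero] at hv
  exact hT j hj ((Valuation.zero_iff _).1 hv.symm)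

/-- The value group of a field generated by `N` elements has rank at most `N + 1`. -/
theorem rank_addValueGroup_le {K : Type} [Field K] (A : ValuationSubring K) {ι : Type} [Fintype ι]
    (q : ι → K) (hq : Subfield.closure (Set.range q) = ⊤) :
    Module.rank ℤ A.AddValueGroup ≤ Fintype.card ι + 1 := by
  obtain ⟨a, ha⟩ := A.exists_valHom_natCast_mem_span
  let R : Subring K := (Int.castRingHom K).range
  have hV : ∀ (r : R) (x : Kˣ), (x : K) = algebraMap R K r →
      A.valHom (.ofMul x) ∈ Submodule.span ℤ {a} := by
    rintro ⟨_, m, rfl⟩ x hx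
    exact valHom_intCast_mem ha m x hx
  have halg : Algebra.IsAlgebraic (Algebra.adjoin R (Set.range q)) K := by
    refine ⟨fun x => ?_⟩
    have hle : Subring.closure (Set.range q) ≤ (Algebra.adjoin R (Set.range q)).toSubring :=
      Subring.closure_le.2 Algebra.subset_adjoin
    obtain ⟨y, hy, z, hz, rfl⟩ := Subfield.mem_closure_iff.1 (hq ▸ Subfield.mem_top x)
    rw [div_eq_mul_inv]
    exact (isAlgebraic_algebraMap (⟨y, hle hy⟩ : Algebra.adjoin R (Set.range q))).mul
      (isAlgebraic_algebraMap (⟨z, hle hz⟩ : Algebra.adjoin R (Set.range q))).inv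
  have htr : Algebra.trdeg R K ≤ Fintype.card ι := by
    refine (Algebra.IsAlgebraic.trdeg_le_cardinalMk R (Set.range q)).trans ?_
    exact Cardinal.mk_range_le.trans (Cardinal.mk_fintype ι).le
  rw [← rank_quotient_add_rank_of_isDomain (Submodule.span ℤ {a})]
  refine add_le_add ?_ ((rank_span_le _).trans (Cardinal.mk_singleton a).le)
  rw [Module.rank_def]
  refine ciSup_le' fun s => ?_
  have hlift : ∀ b : A.AddValueGroup ⧸ Submodule.span ℤ {a}, ∃ y : Kˣ,
      (Submodule.span ℤ {a}).mkQ (A.valHom (.ofMul y)) = b := fun b => by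
    obtain ⟨c, rfl⟩ := Submodule.mkQ_surjective _ b
    obtain ⟨y, rfl⟩ := valHom_surjective c
    exact ⟨y.toMul, rfl⟩
  choose y hy using hlift
  have hind : LinearIndependent ℤ fun i : s.1 =>
      (Submodule.span ℤ {a}).mkQ (A.valHom (.ofMul (y i.1))) := by
    simp only [hy]
    exact s.2
  exact (algebraicIndependent_of_valHom hV hind).cardinalMk_le_trdeg.trans htr

end ValuationSubring

end Rank

/-! ### Ordered groups of finite rank -/

section HahnEmbedding

variable (M : Type*) [AddCommGroup M] [LinearOrder M] [IsOrderedAddMonoid M]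

/-- Elements of distinct Archimedean classes are independent. -/
theorem linearIndependent_archimedeanClass_out :
    LinearIndependent ℤ fun c : FiniteArchimedeanClass M => c.1.out := by
  classical
  rw [linearIndependent_iff']
  intro s g hg
  by_contra! hcon
  obtain ⟨c, hc, hgc⟩ := hcon
  set t := s.filter fun c => g c ≠ 0 with ht
  have hne : t.Nonempty := ⟨c, by simp [ht, hc, hgc]⟩
  have hsum : ∑ c ∈ t, g c • c.1.out = 0 := by
    rw [← hg]
    refine Finset.sum_subset (Finset.filter_subset _ _) fun x hx hxt => ?_
    have : g x = 0 := by simpa [ht, hx] using hxt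
    rw [this, zero_smul]
  have hmk : ∀ c ∈ t, ArchimedeanClass.mk (g c • c.1.out) = c.1 := fun c hc => by
    rw [ArchimedeanClass.mk_smul _ (Finset.mem_filter.1 hc).2, ArchimedeanClass.mk_out]
  have h := ArchimedeanClass.mk_sum hne (a := fun c => g c • c.1.out) fun c hc d hd hcd => by
    simp only [Function.comp_apply]
    rw [hmk c hc, hmk d hd]
    exact hcd
  rw [hsum, hmk _ (t.min'_mem hne), ArchimedeanClass.mk_zero] at h
  exact (t.min' hne).2 h.symm

/-- An ordered abelian group of rank at most `N` embeds in `ℝ^N` with the lexicographic order: it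
has at most `N` Archimedean classes, and Hahn's theorem applies. -/
theorem exists_strictMono_lex {N : ℕ} (h : Module.rank ℤ M ≤ N) :
    ∃ φ : M →+ Lex (Fin N → ℝ), StrictMono φ := by
  classical
  have hcard : Cardinal.mk (FiniteArchimedeanClass M) ≤ N :=
    (linearIndependent_archimedeanClass_out M).cardinal_le_rank.trans h
  have hfin : Finite (FiniteArchimedeanClass M) :=
    Cardinal.lt_aleph0_iff_finite.1 (hcard.trans_lt Cardinal.natCast_lt_aleph0)
  let _ := Fintype.ofFinite (FiniteArchimedeanClass M)
  rw [Cardinal.mk_fintype, Nat.cast_le] at hcard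
  let e : FiniteArchimedeanClass M → Fin N := fun c =>
    Fin.castLE hcard ((Fintype.orderIsoFinOfCardEq _ rfl).symm c)
  have he : StrictMono e := fun a b hab =>
    (Fintype.orderIsoFinOfCardEq (FiniteArchimedeanClass M) rfl).symm.strictMono hab
  obtain ⟨f, hf, -⟩ := hahnEmbedding_isOrderedAddMonoid M
  have hfm : StrictMono f := f.monotone'.strictMono_of_injective hf
  refine ⟨⟨⟨fun x => toLex (Function.extend e (ofLex (f x)).coeff 0), ?_⟩, ?_⟩, fun x y hxy => ?_⟩
  · simp only [map_zero, ofLex_zero, HahnSeries.coeff_zero']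
    rw [Function.extend_zero]
    rfl
  · intro x y
    simp only [map_add, ofLex_add, HahnSeries.coeff_add']
    rw [← toLex_add, ← Function.extend_add, add_zero]
  · obtain ⟨i, hlt, hi⟩ := (HahnSeries.lt_iff _ _).1 (hfm hxy)
    refine ⟨e i, fun k hk => ?_, ?_⟩
    · by_cases hke : ∃ c, e c = k
      · obtain ⟨c, rfl⟩ := hke
        change Function.extend e _ 0 _ = Function.extend e _ 0 _
        rw [he.injective.extend_apply, he.injective.extend_apply]
        exact hlt c (he.lt_iff_lt.1 hk)
      · change Function.extend e _ 0 _ = Function.extend e _ 0 _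
        rw [Function.extend_apply' _ _ _ hke, Function.extend_apply' _ _ _ hke]
    · change Function.extend e _ 0 _ < Function.extend e _ 0 _
      rw [he.injective.extend_apply, he.injective.extend_apply]
      exact hi

end HahnEmbedding

/-! ### Closedness of the set and actions on trees -/

theorem mainTheorem3 (n : ℕ) :
    IsClosed (freeBruhatTitsSet.{w, u, v} n) ∧
    (∀ A : MarkedGroup.{w} n, MarkedGroupSpace.mk A ∈ freeBruhatTitsSet.{w, u, v} n →
      (∃ (Λ : Type) (_ : AddCommGroup Λ) (_ : LinearOrder Λ) (_ : IsOrderedAddMonoid Λ),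
        Module.rank ℚ (ℚ ⊗[ℤ] Λ) ≤ 3 * n + 1 ∧ ActsFreelyOnTree Λ A.G)) ∧
    (∀ A : MarkedGroup.{w} n, MarkedGroupSpace.mk A ∈ freeBruhatTitsSet.{w, u, v} n →
      ActsFreelyOnTree (Lex (Fin (3 * n + 1) → ℝ)) A.G) := by
  have key : ∀ A : MarkedGroup.{w} n, MarkedGroupSpace.mk A ∈ freeBruhatTitsSet.{w, u, v} n →
      ∃ (K : Type) (_ : Field K) (R : ValuationSubring K) (j : A.G →* SL(2, K)),
        HasFreeTrace R j ∧ Module.rank ℤ R.AddValueGroup ≤ (3 * n + 1 : ℕ) := by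
    intro A hA
    obtain ⟨K, _, R, j, q, hq, hj⟩ :=
      exists_hasFreeTrace (mk_mem_freeBruhatTitsSet_iff.1 hA) A.closure_gen
    refine ⟨K, inferInstance, R, j, hj, (R.rank_addValueGroup_le q hq).trans ?_⟩
    simp [mul_comm]
  refine ⟨isClosed_freeBruhatTitsSet n, fun A hA => ?_, fun A hA => ?_⟩
  · obtain ⟨K, _, R, j, hj, hrank⟩ := key A hA
    refine ⟨R.AddValueGroup, inferInstance, inferInstance, inferInstance, ?_, ?_⟩
    · rw [(TensorProduct.isBaseChange ℤ R.AddValueGroup ℚ).rank_eq]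
      exact_mod_cast hrank
    · refine actsFreelyOnTree_of_trace
        (ValuationSubring.addValuation (AddMonoidHom.id _) strictMono_id) j fun g hg h => ?_
      exact hj g hg (ValuationSubring.zero_le_addValuation_iff.1 h)
  · obtain ⟨K, _, R, j, hj, hrank⟩ := key A hA
    obtain ⟨φ, hφ⟩ := exists_strictMono_lex _ hrank
    refine actsFreelyOnTree_of_trace (ValuationSubring.addValuation φ hφ) j fun g hg h => ?_
    exact hj g hg (ValuationSubring.zero_le_addValuation_iff.1 h)
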